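/- Let $\mathcal H_A,\mathcal H_B$ be complex Hilbert spaces (possibly infinite-dimensional) and $\mathcal H_{AB}=\mathcal H_A\otimes\mathcal H_B$ their Hilbert space tensor product. Let $H_A$, $H_B$ be densely defined symmetric operators on $\mathcal H_A$, $\mathcal H_B$ with domains $\mathcal D(A)$, $\mathcal D(B)$, let $H_\partial$ be a linear operator in $\mathcal H_{AB}$ with domain the algebraic tensor product $\mathcal D(A)\otimes\mathcal D(B)$, and suppose that $$H_{AB}=H_A\otimes 1+1\otimes H_B+H_\partial\quad\text{on }\mathcal D(A)\otimes\mathcal D(B)$$ is essentially self-adjoint; denote its self-adjoint closure again by $H_{AB}$. Let $\beta>0$ and suppose that $Z_{AB}=\operatorname{tr}e^{-\beta H_{AB}}<\infty$. Let $\rho_{AB}=e^{-\beta H_{AB}}/Z_{AB}$ be the Gibbs state, with reduced states $\rho_A=\operatorname{tr}_{\mathcal H_B}\rho_{AB}$ and $\rho_B=\operatorname{tr}_{\mathcal H_A}\rho_{AB}$. For a densely defined symmetric operator $T$ and a bounded operator $\rho$, say that $\operatorname{tr}(T\rho)$ exists if the range of $\rho$ lies in the domain of the closure $\overline T$ and $\overline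 T\rho$ is trace class; then $\operatorname{tr}(T\rho)$ denotes the trace of $\overline T\rho$. Assume that the traces $\operatorname{tr}((H_A\otimes 1)\rho_{AB})$, $\operatorname{tr}((1\otimes H_B)\rho_{AB})$, $\operatorname{tr}(H_\partial\rho_{AB})$ and $\operatorname{tr}(H_\partial(\rho_A\otimes\rho_B))$ exist. Then the von Neumann entropies $S(\rho)=-\operatorname{tr}(\rho\ln\rho)$ of $\rho_{AB},\rho_A,\rho_B$ are finite, the trace $\operatorname{tr}(H_\partial(\rho_A\otimes\rho_B-\rho_{AB}))$ exists and is real, and the mutual information $I(A:B)=S(\rho_A)+S(\rho_B)-S(\rho_{AB})$ satisfies $$I(A:B)\le\beta\,\operatorname{tr}\bigl(H_\partial(\rho_A\otimes\rho_B-\rho_{AB})\bigr).$$ -/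

import Mathlib

open scoped TensorProduct InnerProductSpace ENNReal

noncomputable section

namespace QuantumThermal

section SingleSpace

variable {E : Type*} [NormedAddCommGroup E] [InnerProductSpace ℂ E]

/-- An operator is trace class (equivalently, on a Hilbert space, nuclear) if it is an absolutely
convergent sum of rank-one operators: `T z = ∑ₙ ⟪yₙ, z⟫ xₙ` with `∑ₙ ‖xₙ‖ ‖yₙ‖ < ∞`. -/
def IsTraceClass (T : E →L[ℂ] E) : Prop :=
  ∃ x y : ℕ → E, Summable (fun n => ‖x n‖ * ‖y n‖) ∧
    ∀ z : E, HasSum (fun n => ⟪y n, z⟫_ℂ • x n) (T z)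

/-- A symmetric operator, on its domain. -/
def IsSymmetric (T : E →ₗ.[ℂ] E) : Prop :=
  ∀ x y : T.domain, ⟪T x, (y : E)⟫_ℂ = ⟪(x : E), T y⟫_ℂ

/-- The quadratic form of `T` is bounded below. -/
def IsBoundedBelow (T : E →ₗ.[ℂ] E) : Prop :=
  ∃ c : ℝ, ∀ x : T.domain, c * ‖(x : E)‖ ^ 2 ≤ (⟪(x : E), T x⟫_ℂ).re

/-- The infimum of the quadratic form over the unit sphere of the domain. -/
def bottom (T : E →ₗ.[ℂ] E) : ℝ :=
  sInf {r | ∃ x : T.domain, ‖(x : E)‖ = 1 ∧ r = (⟪(x : E), T x⟫_ℂ).re}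

open Classical in
/-- The resolvent `(T - z)⁻¹` as an everywhere defined bounded operator:
`R x = y` iff `y` lies in the domain of `T` and `T y = x + z y`.  (It is `0` if there is none.) -/
def resolventOp (T : E →ₗ.[ℂ] E) (z : ℂ) : E →L[ℂ] E :=
  if h : ∃ R : E →L[ℂ] E, ∀ x y : E, R x = y ↔ (y, x + z • y) ∈ T.graph then h.choose else 0

/-- `K = T ρ` as an everywhere defined bounded operator: the range of `ρ` lies in the domain of
`T`, and `T (ρ x) = K x` for all `x`. -/
def IsProduct (T : E →ₗ.[ℂ] E) (ρ K : E →L[ℂ] E) : Prop :=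
  ∀ x : E, (ρ x, K x) ∈ T.graph

/-- The trace `tr (T ρ)` exists: `T ρ` is everywhere defined and trace class. -/
def HasTrace (T : E →ₗ.[ℂ] E) (ρ : E →L[ℂ] E) : Prop :=
  ∃ K : E →L[ℂ] E, IsProduct T ρ K ∧ IsTraceClass K

open Classical in
/-- The product `T ρ` of an unbounded and a bounded operator, when it is everywhere defined and
bounded (and `0` otherwise). -/
def productOp (T : E →ₗ.[ℂ] E) (ρ : E →L[ℂ] E) : E →L[ℂ] E :=
  if h : ∃ K : E →L[ℂ] E, IsProduct T ρ K then h.choose else 0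

variable [CompleteSpace E]

/-- `T` is essentially self-adjoint: its closure is self-adjoint. -/
def IsEssentiallySelfAdjoint (T : E →ₗ.[ℂ] E) : Prop :=
  IsSelfAdjoint T.closure

variable (E) in
/-- The index set of a fixed orthonormal (Hilbert) basis. -/
def basisIndex : Set E := (exists_hilbertBasis ℂ E).choose

variable (E) in
/-- A fixed orthonormal (Hilbert) basis. -/
def basis : HilbertBasis (basisIndex E) ℂ E := (exists_hilbertBasis ℂ E).choose_spec.choose

/-- The trace of a trace class operator. -/
def trace (T : E →L[ℂ] E) : ℂ := ∑' i, ⟪basis E i, T (basis E i)⟫_ℂ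

/-- The trace of a positive operator, with values in `[0, ∞]`. -/
def posTrace (T : E →L[ℂ] E) : ℝ≥0∞ :=
  ∑' i, ENNReal.ofReal (⟪basis E i, T (basis E i)⟫_ℂ).re

/-- `e^{-β H}` for a self-adjoint operator `H` that is bounded below, and `β > 0`.  With
`m = bottom H`, the operator `R = (H - m + 1)⁻¹` satisfies `0 ≤ R ≤ 1`, and `e^{-β H} = f(R)` by
the functional calculus, where `f(r) = exp(-β x)` for `r = 1 / (x - m + 1)` with `x` real, and
`f(0) = 0`. -/
def expNeg (β : ℝ) (H : E →ₗ.[ℂ] E) : E →L[ℂ] E :=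
  cfc (fun r : ℝ => if r ≤ 0 then 0 else Real.exp (-β * (r⁻¹ + bottom H - 1)))
    (resolventOp H ((bottom H - 1 : ℝ) : ℂ))

open Classical in
/-- The partition function `tr e^{-β H} ∈ [0, ∞]` of a self-adjoint operator `H`, for `β > 0`.  If
`H` is not bounded below, then `e^{-β H}` is unbounded and the trace is infinite. -/
def partitionFunction (β : ℝ) (H : E →ₗ.[ℂ] E) : ℝ≥0∞ :=
  if IsBoundedBelow H then posTrace (expNeg β H) else ⊤

/-- The Gibbs state `e^{-β H} / tr e^{-β H}`. -/
def gibbsState (β : ℝ) (H : E →ₗ.[ℂ] E) : E →L[ℂ] E :=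
  (partitionFunction β H).toReal⁻¹ • expNeg β H

/-- The von Neumann entropy `S(ρ) = -tr (ρ ln ρ) ∈ [0, ∞]` of a density matrix; the operator
`-ρ ln ρ` is given by the functional calculus. -/
def entropy (ρ : E →L[ℂ] E) : ℝ≥0∞ := posTrace (cfc Real.negMulLog ρ)

end SingleSpace

section Bipartite

variable (EA EB : Type*) [NormedAddCommGroup EA] [InnerProductSpace ℂ EA]
  [NormedAddCommGroup EB] [InnerProductSpace ℂ EB]

/-- The Hilbert space tensor product: the completion of the algebraic one. -/
abbrev HilbertTensor : Type _ := UniformSpace.Completion (EA ⊗[ℂ] EB)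

variable {EA EB}

/-- The algebraic tensor product of two subspaces, embedded in the Hilbert tensor product. -/
def domainEmbedding (p : Submodule ℂ EA) (q : Submodule ℂ EB) :
    (p ⊗[ℂ] q) →ₗ[ℂ] HilbertTensor EA EB :=
  (UniformSpace.Completion.toComplₗᵢ (𝕜 := ℂ) (E := EA ⊗[ℂ] EB)).toLinearMap ∘ₗ
    TensorProduct.mapIncl p q

theorem domainEmbedding_injective (p : Submodule ℂ EA) (q : Submodule ℂ EB) :
    Function.Injective (domainEmbedding p q) := by
  have h : Function.Injective (TensorProduct.mapIncl p q) :=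
    TensorProduct.map_injective_of_flat_flat _ _ p.subtype_injective q.subtype_injective
  exact (UniformSpace.Completion.toComplₗᵢ (𝕜 := ℂ) (E := EA ⊗[ℂ] EB)).injective.comp h

/-- The subspace `p ⊗ q` of the Hilbert tensor product (algebraic tensor product). -/
def tensorDomain (p : Submodule ℂ EA) (q : Submodule ℂ EB) : Submodule ℂ (HilbertTensor EA EB) :=
  LinearMap.range (domainEmbedding p q)

/-- The tensor product `S ⊗ T` of two unbounded operators, with domain the algebraic tensor
product of the two domains. -/
def tensorPMap (S : EA →ₗ.[ℂ] EA) (T : EB →ₗ.[ℂ] EB) :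
    HilbertTensor EA EB →ₗ.[ℂ] HilbertTensor EA EB where
  domain := tensorDomain S.domain T.domain
  toFun := (UniformSpace.Completion.toComplₗᵢ (𝕜 := ℂ) (E := EA ⊗[ℂ] EB)).toLinearMap ∘ₗ
    TensorProduct.map S.toFun T.toFun ∘ₗ
    (LinearEquiv.ofInjective (domainEmbedding S.domain T.domain)
      (domainEmbedding_injective S.domain T.domain)).symm.toLinearMap

/-- `S ⊗ 1`, with domain the algebraic tensor product of the domain of `S` and `EB`. -/
def tensorOne (S : EA →ₗ.[ℂ] EA) : HilbertTensor EA EB →ₗ.[ℂ] HilbertTensor EA EB :=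
  tensorPMap S ((LinearMap.id : EB →ₗ[ℂ] EB).toPMap ⊤)

/-- `1 ⊗ T`, with domain the algebraic tensor product of `EA` and the domain of `T`. -/
def oneTensor (T : EB →ₗ.[ℂ] EB) : HilbertTensor EA EB →ₗ.[ℂ] HilbertTensor EA EB :=
  tensorPMap ((LinearMap.id : EA →ₗ[ℂ] EA).toPMap ⊤) T

/-- The tensor product of two bounded operators, on the Hilbert tensor product. -/
def tensorCLM (S : EA →L[ℂ] EA) (T : EB →L[ℂ] EB) :
    HilbertTensor EA EB →L[ℂ] HilbertTensor EA EB :=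
  (TensorProduct.mapL S T).completion

/-- `u ↦ u ⊗ v`. -/
def tmulRight (v : EB) : EA →L[ℂ] HilbertTensor EA EB :=
  UniformSpace.Completion.toComplL ∘L ((TensorProduct.mkL ℂ EA EB).flip v)

/-- `v ↦ u ⊗ v`. -/
def tmulLeft (u : EA) : EB →L[ℂ] HilbertTensor EA EB :=
  UniformSpace.Completion.toComplL ∘L (TensorProduct.mkL ℂ EA EB u)

variable [CompleteSpace EA] [CompleteSpace EB]

/-- The partial trace over the second factor: `⟪u, (tr_B T) u'⟫ = ∑ⱼ ⟪u ⊗ eⱼ, T (u' ⊗ eⱼ)⟫`.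
For trace class `T` the sum of operators converges in norm. -/
def traceOutRight (T : HilbertTensor EA EB →L[ℂ] HilbertTensor EA EB) : EA →L[ℂ] EA :=
  ∑' j, (tmulRight (basis EB j)).adjoint ∘L T ∘L tmulRight (basis EB j)

/-- The partial trace over the first factor. -/
def traceOutLeft (T : HilbertTensor EA EB →L[ℂ] HilbertTensor EA EB) : EB →L[ℂ] EB :=
  ∑' i, (tmulLeft (basis EA i)).adjoint ∘L T ∘L tmulLeft (basis EA i)

/-- The mutual information `I(A:B) = S(ρ_A) + S(ρ_B) - S(ρ_AB)` of a state with finite entropies,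
where `ρ_A` and `ρ_B` are the reduced states. -/
def mutualInformation (ρ : HilbertTensor EA EB →L[ℂ] HilbertTensor EA EB) : ℝ :=
  (entropy (traceOutRight ρ)).toReal + (entropy (traceOutLeft ρ)).toReal - (entropy ρ).toReal

end Bipartite

end QuantumThermal

end

noncomputable section

namespace QuantumThermal

/-!
Every state `σ` satisfies the Gibbs variational principle `S(σ) ≤ β tr (H_AB σ) + ln Z`, with
equality for the Gibbs state `ρ = ρ_AB`; it is Klein's inequality in an eigenbasis of `H_AB`.
Take `σ = ρ_A ⊗ ρ_B` and subtract the equality for `ρ`. On the left, entropy is additive on product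
states, so that `I(A:B)` appears. On the right, `σ` and `ρ` have the same marginals, hence the same
local energies, and only `H_∂` survives.

Neither operator sums nor partial traces behave well with respect to closures. The products `T ρ`
are therefore used in the weak form `⟪T z, ρ x⟫ = ⟪z, K x⟫`, which suffices to evaluate the energy
in the eigenbasis. Passing to the weak form needs the symmetry of `H_∂`, which follows from that of
`H_A`, `H_B` and `H_AB`.
-/

open scoped ComplexOrder

section Hilbert

variable {𝕜 E F ι : Type*} [RCLike 𝕜] [NormedAddCommGroup E] [InnerProductSpace 𝕜 E]
  [NormedAddCommGroup F] [InnerProductSpace 𝕜 F]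

theorem hasSum_norm_inner_sq (b : HilbertBasis ι 𝕜 E) (x : E) :
    HasSum (fun i => ‖⟪b i, x⟫_𝕜‖ ^ 2) (‖x‖ ^ 2) := by
  have h := RCLike.reCLM.hasSum (b.hasSum_inner_mul_inner x x)
  rw [RCLike.reCLM_apply, inner_self_eq_norm_sq (𝕜 := 𝕜) x] at h
  refine h.congr_fun fun i => ?_
  rw [← inner_conj_symm x (b i), RCLike.conj_mul, ← RCLike.ofReal_pow, RCLike.ofReal_re]

theorem tsum_ofReal_norm_inner_sq (b : HilbertBasis ι 𝕜 E) (x : E) :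
    ∑' i, ENNReal.ofReal (‖⟪b i, x⟫_𝕜‖ ^ 2) = ENNReal.ofReal (‖x‖ ^ 2) := by
  have h := hasSum_norm_inner_sq b x
  rw [← ENNReal.ofReal_tsum_of_nonneg (fun _ => sq_nonneg _) h.summable, h.tsum_eq]

theorem eq_of_forall_inner_hilbertBasis_eq (b : HilbertBasis ι 𝕜 E) {x y : E}
    (h : ∀ i, ⟪b i, x⟫_𝕜 = ⟪b i, y⟫_𝕜) : x = y := by
  refine b.repr.injective (lp.ext (funext fun i => ?_))
  simpa only [b.repr_apply_apply] using h i

theorem isCompactOperator_rankOne (x : F) (y : E) :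
    IsCompactOperator (InnerProductSpace.rankOne 𝕜 x y) := by
  rw [InnerProductSpace.rankOne_def']
  exact (isCompactOperator_of_locallyCompactSpace_rng
    (ContinuousLinearMap.toSpanSingleton 𝕜 x)).comp_clm (innerSL 𝕜 y)

end Hilbert

section Nuclear

variable {𝕜 E F ι κ : Type*} [RCLike 𝕜] [NormedAddCommGroup E] [InnerProductSpace 𝕜 E]
  [NormedAddCommGroup F] [InnerProductSpace 𝕜 F]

/-- `T = ∑ᵢ ⟪yᵢ, ·⟫ xᵢ` is an absolutely convergent sum of rank-one operators. In contrast to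
`IsTraceClass` the index type is arbitrary, so that double sums need not be enumerated. -/
def IsNuclearSum (x : ι → F) (y : ι → E) (T : E →L[𝕜] F) : Prop :=
  Summable (fun i => ‖x i‖ * ‖y i‖) ∧ ∀ z : E, HasSum (fun i => ⟪y i, z⟫_𝕜 • x i) (T z)

theorem isNuclearSum_extend_zero {x : ι → F} {y : ι → E} {T : E →L[𝕜] F} {e : ι → κ}
    (he : Function.Injective e) :
    IsNuclearSum (Function.extend e x 0) (Function.extend e y 0) T ↔ IsNuclearSum x y T := by
  have hzero (k : κ) (hk : k ∉ Set.range e) : Function.extend e x 0 k = 0 :=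
    Function.extend_apply' x (0 : κ → F) k hk
  refine and_congr ?_ (forall_congr' fun z => ?_)
  · rw [← he.summable_iff fun k hk => by simp [hzero k hk]]
    simp [Function.comp_def, he.extend_apply]
  · rw [← he.hasSum_iff fun k hk => by simp [hzero k hk]]
    simp [Function.comp_def, he.extend_apply]

theorem IsNuclearSum.restrict_support {x : ι → F} {y : ι → E} {T : E →L[𝕜] F}
    (h : IsNuclearSum x y T) :
    IsNuclearSum (fun i : Function.support fun i => ‖x i‖ * ‖y i‖ => x i) (fun i => y i) T := by
  refine ⟨h.1.subtype _, fun z => ?_⟩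
  refine (hasSum_subtype_iff_of_support_subset (Function.support_subset_iff'.2 fun i hi => ?_)).2
    (h.2 z)
  have : x i = 0 ∨ y i = 0 := by simpa [or_iff_not_imp_left] using hi
  rcases this with h | h <;> simp [h]

theorem isNuclearSum_tsum_rankOne [CompleteSpace F] {x : ι → F} {y : ι → E}
    (hs : Summable fun i => ‖x i‖ * ‖y i‖) :
    IsNuclearSum x y (∑' i, InnerProductSpace.rankOne 𝕜 (x i) (y i)) := by
  have hsum : Summable fun i => InnerProductSpace.rankOne 𝕜 (x i) (y i) :=
    Summable.of_norm (by simpa using hs)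
  exact ⟨hs, fun z => by simpa using hsum.hasSum.mapL (ContinuousLinearMap.apply 𝕜 F z)⟩

theorem IsNuclearSum.hasSum_rankOne [CompleteSpace F] {x : ι → F} {y : ι → E} {T : E →L[𝕜] F}
    (h : IsNuclearSum x y T) : HasSum (fun i => InnerProductSpace.rankOne 𝕜 (x i) (y i)) T := by
  have hsum : Summable fun i => InnerProductSpace.rankOne 𝕜 (x i) (y i) :=
    Summable.of_norm (by simpa using h.1)
  convert hsum.hasSum using 1
  ext z
  exact (h.2 z).unique ((isNuclearSum_tsum_rankOne h.1).2 z)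

theorem IsNuclearSum.isCompactOperator [CompleteSpace F] {x : ι → F} {y : ι → E} {T : E →L[𝕜] F}
    (h : IsNuclearSum x y T) : IsCompactOperator T := by
  refine isCompactOperator_of_tendsto h.hasSum_rankOne (Filter.Eventually.of_forall fun s => ?_)
  exact Submodule.sum_mem (compactOperator (RingHom.id 𝕜) E F)
    fun i _ => isCompactOperator_rankOne (x i) (y i)

theorem IsNuclearSum.add {x : ι → F} {y : ι → E} {S : E →L[𝕜] F} {x' : κ → F} {y' : κ → E}
    {T : E →L[𝕜] F} (hS : IsNuclearSum x y S) (hT : IsNuclearSum x' y' T) :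
    IsNuclearSum (Sum.elim x x') (Sum.elim y y') (S + T) :=
  ⟨(HasSum.sum (f := fun i => ‖Sum.elim x x' i‖ * ‖Sum.elim y y' i‖)
      hS.1.hasSum hT.1.hasSum).summable, fun z => HasSum.sum (hS.2 z) (hT.2 z)⟩

theorem IsNuclearSum.neg {x : ι → F} {y : ι → E} {T : E →L[𝕜] F} (h : IsNuclearSum x y T) :
    IsNuclearSum (fun i => -x i) y (-T) :=
  ⟨by simpa using h.1, fun z => by simpa using (h.2 z).neg⟩

theorem summable_mul_of_hasSum_sq {X Y : ι → ℝ} {F G : ι → κ → ℝ}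
    (hX : ∀ i, 0 ≤ X i) (hY : ∀ i, 0 ≤ Y i) (hXY : Summable fun i => X i * Y i)
    (hF : ∀ i k, 0 ≤ F i k) (hG : ∀ i k, 0 ≤ G i k)
    (hFX : ∀ i, HasSum (fun k => F i k ^ 2) (X i ^ 2))
    (hGY : ∀ i, HasSum (fun k => G i k ^ 2) (Y i ^ 2)) :
    Summable fun p : ι × κ => F p.1 p.2 * G p.1 p.2 := by
  have cauchySchwarz : ∀ i, ∃ C, 0 ≤ C ∧ C ≤ X i * Y i ∧ HasSum (fun k => F i k * G i k) C :=
    fun i => Real.inner_le_Lp_mul_Lq_hasSum_of_nonneg Real.HolderConjugate.two_two (hX i) (hY i)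
      (hF i) (hG i) (by simpa using hFX i) (by simpa using hGY i)
  choose C hC_nonneg hC_le hC_sum using cauchySchwarz
  rw [summable_prod_of_nonneg fun p => mul_nonneg (hF _ _) (hG _ _)]
  refine ⟨fun i => (hC_sum i).summable, ?_⟩
  simp only [(hC_sum _).tsum_eq]
  exact Summable.of_nonneg_of_le hC_nonneg hC_le hXY

theorem summable_inner_mul_inner {x y : ι → E} (hs : Summable fun i => ‖x i‖ * ‖y i‖)
    (b : HilbertBasis κ 𝕜 E) :
    Summable fun p : ι × κ => ⟪y p.1, b p.2⟫_𝕜 * ⟪b p.2, x p.1⟫_𝕜 := by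
  refine Summable.of_norm ?_
  simp only [norm_mul]
  refine summable_mul_of_hasSum_sq (X := fun i => ‖y i‖) (Y := fun i => ‖x i‖)
    (F := fun i k => ‖⟪y i, b k⟫_𝕜‖) (G := fun i k => ‖⟪b k, x i⟫_𝕜‖)
    (fun _ => norm_nonneg _) (fun _ => norm_nonneg _) (by simpa only [mul_comm] using hs)
    (fun _ _ => norm_nonneg _) (fun _ _ => norm_nonneg _) (fun i => ?_)
    fun i => hasSum_norm_inner_sq b (x i)
  simpa only [norm_inner_symm] using hasSum_norm_inner_sq b (y i)

theorem IsNuclearSum.hasSum_inner_apply {x y : ι → E} {T : E →L[𝕜] E}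
    (h : IsNuclearSum x y T) (b : HilbertBasis κ 𝕜 E) :
    HasSum (fun k => ⟪b k, T (b k)⟫_𝕜) (∑' i, ⟪y i, x i⟫_𝕜) := by
  have hs := (summable_inner_mul_inner h.1 b).hasSum
  rw [(hs.prod_fiberwise fun i => b.hasSum_inner_mul_inner (y i) (x i)).tsum_eq]
  refine ((Equiv.prodComm κ ι).hasSum_iff.2 hs).prod_fiberwise fun k => ?_
  simpa [inner_smul_right] using (h.2 (b k)).mapL (innerSL 𝕜 (b k))

end Nuclear

section TraceClass

variable {E ι κ : Type*} [NormedAddCommGroup E] [InnerProductSpace ℂ E] {S T : E →L[ℂ] E}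

theorem IsTraceClass.exists_isNuclearSum (h : IsTraceClass T) :
    ∃ x y : ℕ → E, IsNuclearSum x y T := h

theorem IsNuclearSum.isTraceClass {x y : ι → E} (h : IsNuclearSum x y T) : IsTraceClass T := by
  obtain ⟨e, he⟩ := Set.countable_iff_exists_injective.1 h.1.countable_support
  exact ⟨_, _, (isNuclearSum_extend_zero he).2 h.restrict_support⟩

theorem IsTraceClass.add (hS : IsTraceClass S) (hT : IsTraceClass T) : IsTraceClass (S + T) := by
  obtain ⟨x, y, hS⟩ := hS.exists_isNuclearSum
  obtain ⟨x', y', hT⟩ := hT.exists_isNuclearSum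
  exact (hS.add hT).isTraceClass

theorem IsTraceClass.sub (hS : IsTraceClass S) (hT : IsTraceClass T) : IsTraceClass (S - T) := by
  obtain ⟨x, y, hT⟩ := hT.exists_isNuclearSum
  rw [sub_eq_add_neg]
  exact hS.add hT.neg.isTraceClass

variable [CompleteSpace E]

theorem IsTraceClass.isCompactOperator (h : IsTraceClass T) : IsCompactOperator T := by
  obtain ⟨x, y, h⟩ := h.exists_isNuclearSum
  exact h.isCompactOperator

theorem IsNuclearSum.trace_eq {x y : ι → E} (h : IsNuclearSum x y T) :
    trace T = ∑' i, ⟪y i, x i⟫_ℂ :=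
  (h.hasSum_inner_apply (basis E)).tsum_eq

theorem IsTraceClass.hasSum_trace (h : IsTraceClass T) (b : HilbertBasis κ ℂ E) :
    HasSum (fun k => ⟪b k, T (b k)⟫_ℂ) (trace T) := by
  obtain ⟨x, y, h⟩ := h.exists_isNuclearSum
  rw [h.trace_eq]
  exact h.hasSum_inner_apply b

theorem trace_add (hS : IsTraceClass S) (hT : IsTraceClass T) :
    trace (S + T) = trace S + trace T := by
  refine ((hS.add hT).hasSum_trace (basis E)).unique ?_
  simpa [inner_add_right] using (hS.hasSum_trace (basis E)).add (hT.hasSum_trace (basis E))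

theorem trace_sub (hS : IsTraceClass S) (hT : IsTraceClass T) :
    trace (S - T) = trace S - trace T := by
  refine ((hS.sub hT).hasSum_trace (basis E)).unique ?_
  simpa [inner_sub_right] using (hS.hasSum_trace (basis E)).sub (hT.hasSum_trace (basis E))

end TraceClass

section PosTrace

variable {E κ : Type*} [NormedAddCommGroup E] [InnerProductSpace ℂ E] {T : E →L[ℂ] E}

theorem nonneg_iff_forall_inner_nonneg : 0 ≤ T ↔ ∀ x, 0 ≤ ⟪x, T x⟫_ℂ := by
  rw [ContinuousLinearMap.nonneg_iff_isPositive]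
  refine ⟨fun h => h.inner_nonneg_right, fun h => ?_⟩
  refine ContinuousLinearMap.isPositive_iff_complex T |>.2 fun x => ?_
  have hx : 0 ≤ ⟪T x, x⟫_ℂ := by
    rw [← inner_conj_symm]
    exact star_nonneg_iff.2 (h x)
  exact ⟨(Complex.eq_re_of_ofReal_le hx).symm, (Complex.nonneg_iff.1 hx).1⟩

theorem re_inner_nonneg (hT : 0 ≤ T) (x : E) : 0 ≤ (⟪x, T x⟫_ℂ).re :=
  (Complex.nonneg_iff.1 (nonneg_iff_forall_inner_nonneg.1 hT x)).1

variable [CompleteSpace E]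

theorem inner_sqrt_left (x y : E) : ⟪CFC.sqrt T x, y⟫_ℂ = ⟪x, CFC.sqrt T y⟫_ℂ :=
  ((ContinuousLinearMap.nonneg_iff_isPositive _).1 (CFC.sqrt_nonneg T)).inner_left_eq_inner_right
    x y

theorem sqrt_apply_sqrt_apply (hT : 0 ≤ T) (x : E) : CFC.sqrt T (CFC.sqrt T x) = T x :=
  congr($(CFC.sqrt_mul_sqrt_self T hT) x)

theorem re_inner_eq_norm_sqrt_sq (hT : 0 ≤ T) (x : E) :
    (⟪x, T x⟫_ℂ).re = ‖CFC.sqrt T x‖ ^ 2 := by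
  rw [← sqrt_apply_sqrt_apply hT, ← inner_sqrt_left]
  exact inner_self_eq_norm_sq (𝕜 := ℂ) _

theorem posTrace_eq_tsum (hT : 0 ≤ T) (b : HilbertBasis κ ℂ E) :
    posTrace T = ∑' k, ENNReal.ofReal (⟪b k, T (b k)⟫_ℂ).re := by
  simp only [posTrace, re_inner_eq_norm_sqrt_sq hT]
  calc ∑' i, ENNReal.ofReal (‖CFC.sqrt T (basis E i)‖ ^ 2)
      = ∑' i, ∑' k, ENNReal.ofReal (‖⟪b k, CFC.sqrt T (basis E i)⟫_ℂ‖ ^ 2) := by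
        simp only [tsum_ofReal_norm_inner_sq]
    _ = ∑' k, ∑' i, ENNReal.ofReal (‖⟪b k, CFC.sqrt T (basis E i)⟫_ℂ‖ ^ 2) := ENNReal.tsum_comm
    _ = ∑' k, ∑' i, ENNReal.ofReal (‖⟪basis E i, CFC.sqrt T (b k)⟫_ℂ‖ ^ 2) := by
        simp only [← inner_sqrt_left, norm_inner_symm]
    _ = ∑' k, ENNReal.ofReal (‖CFC.sqrt T (b k)‖ ^ 2) := by
        simp only [tsum_ofReal_norm_inner_sq]

theorem isTraceClass_of_posTrace_lt_top (hT : 0 ≤ T) (h : posTrace T < ⊤) : IsTraceClass T := by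
  refine IsNuclearSum.isTraceClass (x := fun i => CFC.sqrt T (basis E i))
    (y := fun i => CFC.sqrt T (basis E i)) ⟨?_, fun z => ?_⟩
  · simp only [posTrace, re_inner_eq_norm_sqrt_sq hT] at h
    refine (ENNReal.summable_toReal h.ne).congr fun i => ?_
    rw [ENNReal.toReal_ofReal (sq_nonneg _), sq]
  · have := ((basis E).hasSum_repr (CFC.sqrt T z)).mapL (CFC.sqrt T)
    simpa [HilbertBasis.repr_apply_apply, inner_sqrt_left, sqrt_apply_sqrt_apply hT] using this

theorem trace_nonneg (hT : 0 ≤ T) (h : IsTraceClass T) : 0 ≤ trace T :=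
  (h.hasSum_trace (basis E)).nonneg fun i => nonneg_iff_forall_inner_nonneg.1 hT (basis E i)

theorem posTrace_eq_ofReal_re_trace (hT : 0 ≤ T) (h : IsTraceClass T) :
    posTrace T = ENNReal.ofReal (trace T).re := by
  have hsum := Complex.hasSum_re (h.hasSum_trace (basis E))
  rw [posTrace, ← ENNReal.ofReal_tsum_of_nonneg (fun i => re_inner_nonneg hT _) hsum.summable,
    hsum.tsum_eq]

theorem ofReal_re_inner_le_posTrace_mul (hT : 0 ≤ T) (x : E) :
    ENNReal.ofReal (⟪x, T x⟫_ℂ).re ≤ posTrace T * ENNReal.ofReal (‖x‖ ^ 2) := by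
  rw [posTrace, ← ENNReal.tsum_mul_right, re_inner_eq_norm_sqrt_sq hT,
    ← tsum_ofReal_norm_inner_sq (basis E)]
  refine ENNReal.tsum_le_tsum fun i => ?_
  rw [re_inner_eq_norm_sqrt_sq hT, ← ENNReal.ofReal_mul (sq_nonneg _), ← inner_sqrt_left,
    ← mul_pow]
  gcongr
  exact norm_inner_le_norm _ _

theorem le_one_of_posTrace_le_one (hT : 0 ≤ T) (h : posTrace T ≤ 1) : T ≤ 1 := by
  rw [← sub_nonneg, nonneg_iff_forall_inner_nonneg]
  intro x
  have hle : (⟪x, T x⟫_ℂ).re ≤ ‖x‖ ^ 2 := (ENNReal.ofReal_le_ofReal_iff (sq_nonneg _)).1 <|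
    (ofReal_re_inner_le_posTrace_mul hT x).trans (mul_le_of_le_one_left' h)
  have him := (Complex.nonneg_iff.1 (nonneg_iff_forall_inner_nonneg.1 hT x)).2
  rw [sub_apply, one_apply_eq_self, inner_sub_right, inner_self_eq_norm_sq_to_K,
    Complex.nonneg_iff]
  have hre : ((‖x‖ : ℂ) ^ 2).re = ‖x‖ ^ 2 := by norm_cast
  have him' : ((‖x‖ : ℂ) ^ 2).im = 0 := by norm_cast
  simpa [← him, hre, him'] using hle

/-- A density operator: a positive operator of trace one. -/
structure IsDensityOperator (ρ : E →L[ℂ] E) : Prop where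
  nonneg : 0 ≤ ρ
  posTrace_eq_one : posTrace ρ = 1

variable {ρ : E →L[ℂ] E}

theorem IsDensityOperator.isTraceClass (hρ : IsDensityOperator ρ) : IsTraceClass ρ :=
  isTraceClass_of_posTrace_lt_top hρ.nonneg (hρ.posTrace_eq_one ▸ ENNReal.one_lt_top)

theorem IsDensityOperator.trace_eq_one (hρ : IsDensityOperator ρ) : trace ρ = 1 := by
  have h := posTrace_eq_ofReal_re_trace hρ.nonneg hρ.isTraceClass
  have htrace := Complex.nonneg_iff.1 (trace_nonneg hρ.nonneg hρ.isTraceClass)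
  rw [hρ.posTrace_eq_one, eq_comm, ENNReal.ofReal_eq_one] at h
  exact Complex.ext h htrace.2.symm

theorem isDensityOperator_of_trace_eq_one (h0 : 0 ≤ ρ) (h : IsTraceClass ρ) (h1 : trace ρ = 1) :
    IsDensityOperator ρ :=
  ⟨h0, by simp [posTrace_eq_ofReal_re_trace h0 h, h1]⟩

theorem IsDensityOperator.le_one (hρ : IsDensityOperator ρ) : ρ ≤ 1 :=
  le_one_of_posTrace_le_one hρ.nonneg hρ.posTrace_eq_one.le

end PosTrace

section Tensor

variable {EA EB : Type*} [NormedAddCommGroup EA] [InnerProductSpace ℂ EA]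
  [NormedAddCommGroup EB] [InnerProductSpace ℂ EB]

/-- The elementary tensor `u ⊗ v` in the Hilbert tensor product. -/
def pureTensor (u : EA) (v : EB) : HilbertTensor EA EB := ((u ⊗ₜ[ℂ] v : EA ⊗[ℂ] EB) : _)

theorem tmulRight_apply (u : EA) (v : EB) : tmulRight v u = pureTensor u v := rfl

theorem tmulLeft_apply (u : EA) (v : EB) : tmulLeft u v = pureTensor u v := rfl

theorem inner_pureTensor (u u' : EA) (v v' : EB) :
    ⟪pureTensor u v, pureTensor u' v'⟫_ℂ = ⟪u, u'⟫_ℂ * ⟪v, v'⟫_ℂ := by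
  simp [pureTensor, UniformSpace.Completion.inner_coe]

theorem norm_pureTensor (u : EA) (v : EB) : ‖pureTensor u v‖ = ‖u‖ * ‖v‖ := by
  simp [pureTensor]

theorem pureTensor_smul_smul (c d : ℂ) (u : EA) (v : EB) :
    pureTensor (c • u) (d • v) = (c * d) • pureTensor u v := by
  rw [← tmulRight_apply, map_smul, tmulRight_apply, ← tmulLeft_apply, map_smul, smul_smul,
    tmulLeft_apply]

theorem rankOne_pureTensor (x y u : EA) (x' y' v : EB) :
    InnerProductSpace.rankOne ℂ (pureTensor x x') (pureTensor y y') (pureTensor u v) =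
      pureTensor (⟪y, u⟫_ℂ • x) (⟪y', v⟫_ℂ • x') := by
  rw [InnerProductSpace.rankOne_apply, inner_pureTensor, pureTensor_smul_smul]

theorem tensorCLM_pureTensor (S : EA →L[ℂ] EA) (T : EB →L[ℂ] EB) (u : EA) (v : EB) :
    tensorCLM S T (pureTensor u v) = pureTensor (S u) (T v) := by
  simp [tensorCLM, pureTensor]

theorem clm_ext_pureTensor {F : Type*} [NormedAddCommGroup F] [NormedSpace ℂ F]
    {S T : HilbertTensor EA EB →L[ℂ] F} (h : ∀ u v, S (pureTensor u v) = T (pureTensor u v)) :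
    S = T := by
  ext z
  induction z using UniformSpace.Completion.induction_on with
  | hp => exact isClosed_eq (by fun_prop) (by fun_prop)
  | ih t =>
    induction t with
    | zero => rw [UniformSpace.Completion.coe_zero, map_zero, map_zero]
    | tmul u v => exact h u v
    | add s t hs ht => rw [UniformSpace.Completion.coe_add, map_add, map_add, hs, ht]

theorem ext_inner_pureTensor {x y : HilbertTensor EA EB}
    (h : ∀ u v, ⟪pureTensor u v, x⟫_ℂ = ⟪pureTensor u v, y⟫_ℂ) : x = y := by
  have hinner : innerSL ℂ x = innerSL ℂ y := clm_ext_pureTensor fun u v => by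
    rw [innerSL_apply_apply, innerSL_apply_apply, ← inner_conj_symm, h, inner_conj_symm]
  exact ext_inner_right ℂ fun z => congr($hinner z)

theorem tensorCLM_comp_tensorCLM (S S' : EA →L[ℂ] EA) (T T' : EB →L[ℂ] EB) :
    tensorCLM S T ∘L tensorCLM S' T' = tensorCLM (S ∘L S') (T ∘L T') :=
  clm_ext_pureTensor fun u v => by
    simp only [ContinuousLinearMap.comp_apply, tensorCLM_pureTensor]

variable {ι κ : Type*}

theorem orthonormal_pureTensor {a : ι → EA} {b : κ → EB} (ha : Orthonormal ℂ a)
    (hb : Orthonormal ℂ b) : Orthonormal ℂ fun p : ι × κ => pureTensor (a p.1) (b p.2) := by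
  classical
  rw [orthonormal_iff_ite] at ha hb ⊢
  rintro ⟨i, j⟩ ⟨i', j'⟩
  rw [inner_pureTensor, ha, hb]
  by_cases hi : i = i' <;> by_cases hj : j = j' <;> simp [hi, hj]

theorem IsNuclearSum.tensorCLM {S : EA →L[ℂ] EA} {T : EB →L[ℂ] EB} {x y : ι → EA}
    {x' y' : κ → EB} (hS : IsNuclearSum x y S) (hT : IsNuclearSum x' y' T) :
    IsNuclearSum (fun p : ι × κ => pureTensor (x p.1) (x' p.2))
      (fun p => pureTensor (y p.1) (y' p.2)) (tensorCLM S T) := by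
  have hs : Summable fun p : ι × κ =>
      ‖pureTensor (x p.1) (x' p.2)‖ * ‖pureTensor (y p.1) (y' p.2)‖ := by
    refine (hS.1.mul_of_nonneg hT.1 (fun _ => by positivity) (fun _ => by positivity)).congr
      fun p => ?_
    simp only [norm_pureTensor]
    ring
  convert isNuclearSum_tsum_rankOne (𝕜 := ℂ) hs using 1
  refine clm_ext_pureTensor fun u v => ?_
  have hsum := (isNuclearSum_tsum_rankOne (𝕜 := ℂ) hs).2 (pureTensor u v)
  simp only [← InnerProductSpace.rankOne_apply, rankOne_pureTensor] at hsum
  rw [tensorCLM_pureTensor]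
  refine HasSum.unique ?_ (hsum.prod_fiberwise fun i => (hT.2 v).mapL (tmulLeft (⟪y i, u⟫_ℂ • x i)))
  exact (hS.2 u).mapL (tmulRight (T v))

theorem IsTraceClass.tensorCLM {S : EA →L[ℂ] EA} {T : EB →L[ℂ] EB} (hS : IsTraceClass S)
    (hT : IsTraceClass T) : IsTraceClass (tensorCLM S T) := by
  obtain ⟨x, y, hS⟩ := hS.exists_isNuclearSum
  obtain ⟨x', y', hT⟩ := hT.exists_isNuclearSum
  exact (hS.tensorCLM hT).isTraceClass

variable [CompleteSpace EA] [CompleteSpace EB]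

theorem adjoint_tensorCLM (S : EA →L[ℂ] EA) (T : EB →L[ℂ] EB) :
    (tensorCLM S T).adjoint = tensorCLM S.adjoint T.adjoint := by
  refine clm_ext_pureTensor fun u v => ext_inner_pureTensor fun u' v' => ?_
  simp only [ContinuousLinearMap.adjoint_inner_right, tensorCLM_pureTensor, inner_pureTensor]

theorem tensorCLM_nonneg {S : EA →L[ℂ] EA} {T : EB →L[ℂ] EB} (hS : 0 ≤ S) (hT : 0 ≤ T) :
    0 ≤ tensorCLM S T := by
  have hsqrt : tensorCLM S T =
      (tensorCLM (CFC.sqrt S) (CFC.sqrt T)).adjoint ∘L tensorCLM (CFC.sqrt S) (CFC.sqrt T) := by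
    rw [adjoint_tensorCLM, (CFC.sqrt_nonneg S).isSelfAdjoint.adjoint_eq,
      (CFC.sqrt_nonneg T).isSelfAdjoint.adjoint_eq, tensorCLM_comp_tensorCLM]
    exact congr_arg₂ tensorCLM (CFC.sqrt_mul_sqrt_self S hS).symm
      (CFC.sqrt_mul_sqrt_self T hT).symm
  rw [hsqrt, ContinuousLinearMap.nonneg_iff_isPositive]
  exact ContinuousLinearMap.isPositive_adjoint_comp_self _

theorem eq_zero_of_forall_inner_pureTensor_basis (a : HilbertBasis ι ℂ EA)
    (b : HilbertBasis κ ℂ EB) {x : HilbertTensor EA EB}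
    (hx : ∀ i j, ⟪pureTensor (a i) (b j), x⟫_ℂ = 0) : x = 0 := by
  have hadjoint (j : κ) : (tmulRight (EA := EA) (b j)).adjoint x = 0 :=
    eq_of_forall_inner_hilbertBasis_eq a fun i => by
      rw [ContinuousLinearMap.adjoint_inner_right, tmulRight_apply, hx, inner_zero_right]
  refine ext_inner_pureTensor fun u v => ?_
  have hu : (tmulLeft (EB := EB) u).adjoint x = 0 :=
    eq_of_forall_inner_hilbertBasis_eq b fun j => by
      rw [ContinuousLinearMap.adjoint_inner_right, tmulLeft_apply, ← tmulRight_apply,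
        ← ContinuousLinearMap.adjoint_inner_right, hadjoint, inner_zero_right, inner_zero_right]
  rw [← tmulLeft_apply, ← ContinuousLinearMap.adjoint_inner_right, hu, inner_zero_right,
    inner_zero_right]

/-- The product of two Hilbert bases, a Hilbert basis of the tensor product. -/
def tensorHilbertBasis (a : HilbertBasis ι ℂ EA) (b : HilbertBasis κ ℂ EB) :
    HilbertBasis (ι × κ) ℂ (HilbertTensor EA EB) :=
  HilbertBasis.mkOfOrthogonalEqBot (orthonormal_pureTensor a.orthonormal b.orthonormal) <|
    (Submodule.eq_bot_iff _).2 fun _ hx => eq_zero_of_forall_inner_pureTensor_basis a b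
      fun i j => hx _ (Submodule.subset_span ⟨(i, j), rfl⟩)

theorem tensorHilbertBasis_apply (a : HilbertBasis ι ℂ EA) (b : HilbertBasis κ ℂ EB) (p : ι × κ) :
    tensorHilbertBasis a b p = pureTensor (a p.1) (b p.2) := by
  rw [tensorHilbertBasis, HilbertBasis.coe_mkOfOrthogonalEqBot]

theorem trace_tensorCLM {S : EA →L[ℂ] EA} {T : EB →L[ℂ] EB} (hS : IsTraceClass S)
    (hT : IsTraceClass T) : trace (tensorCLM S T) = trace S * trace T := by
  have hsum := (hS.tensorCLM hT).hasSum_trace (tensorHilbertBasis (basis EA) (basis EB))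
  simp only [tensorHilbertBasis_apply, tensorCLM_pureTensor, inner_pureTensor] at hsum
  have hrow := hsum.prod_fiberwise (g := fun i => ⟪basis EA i, S (basis EA i)⟫_ℂ * trace T)
    fun i => (hT.hasSum_trace (basis EB)).mul_left ⟪basis EA i, S (basis EA i)⟫_ℂ
  exact hrow.unique ((hS.hasSum_trace (basis EA)).mul_right _)

theorem IsDensityOperator.tensorCLM {ρ : EA →L[ℂ] EA} {σ : EB →L[ℂ] EB}
    (hρ : IsDensityOperator ρ) (hσ : IsDensityOperator σ) :
    IsDensityOperator (tensorCLM ρ σ) :=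
  isDensityOperator_of_trace_eq_one (tensorCLM_nonneg hρ.nonneg hσ.nonneg)
    (hρ.isTraceClass.tensorCLM hσ.isTraceClass) <| by
      rw [trace_tensorCLM hρ.isTraceClass hσ.isTraceClass, hρ.trace_eq_one, hσ.trace_eq_one,
        one_mul]

end Tensor

section PartialTrace

variable {F G ι κ : Type*} [NormedAddCommGroup F] [InnerProductSpace ℂ F] [CompleteSpace F]
  [NormedAddCommGroup G] [InnerProductSpace ℂ G] [CompleteSpace G]
  {V : κ → F →L[ℂ] G} {T : G →L[ℂ] G}

/-- The identity `∑ⱼ Vⱼ Vⱼ* = 1` in the weak sense. The maps `u ↦ u ⊗ eⱼ` for a Hilbert basis `e`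
of one factor of a tensor product are the main example. -/
def ResolvesIdentity (V : κ → F →L[ℂ] G) : Prop :=
  ∀ x y, HasSum (fun j => ⟪(V j).adjoint x, (V j).adjoint y⟫_ℂ) ⟪x, y⟫_ℂ

/-- The operator `∑ⱼ Vⱼ* T Vⱼ`, a common form of the two partial traces on a tensor product. -/
def partialTrace (V : κ → F →L[ℂ] G) (T : G →L[ℂ] G) : F →L[ℂ] F :=
  ∑' j, (V j).adjoint ∘L T ∘L V j

theorem ResolvesIdentity.hasSum_norm_sq (hV : ResolvesIdentity V) (z : G) :
    HasSum (fun j => ‖(V j).adjoint z‖ ^ 2) (‖z‖ ^ 2) := by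
  simpa [inner_self_eq_norm_sq_to_K, ← Complex.ofReal_pow] using Complex.hasSum_re (hV z z)

theorem ResolvesIdentity.summable_norm_mul_norm (hV : ResolvesIdentity V) {x y : ι → G}
    (hs : Summable fun i => ‖x i‖ * ‖y i‖) :
    Summable fun p : ι × κ => ‖(V p.2).adjoint (x p.1)‖ * ‖(V p.2).adjoint (y p.1)‖ :=
  summable_mul_of_hasSum_sq (F := fun i j => ‖(V j).adjoint (x i)‖)
    (G := fun i j => ‖(V j).adjoint (y i)‖) (fun _ => norm_nonneg _) (fun _ => norm_nonneg _) hs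
    (fun _ _ => norm_nonneg _) (fun _ _ => norm_nonneg _) (fun i => hV.hasSum_norm_sq (x i))
    fun i => hV.hasSum_norm_sq (y i)

theorem adjoint_comp_rankOne_comp (W : F →L[ℂ] G) (x y : G) :
    W.adjoint ∘L InnerProductSpace.rankOne ℂ x y ∘L W =
      InnerProductSpace.rankOne ℂ (W.adjoint x) (W.adjoint y) := by
  ext z
  simp [ContinuousLinearMap.adjoint_inner_left]

theorem IsNuclearSum.hasSum_adjoint_comp_comp (hV : ResolvesIdentity V) {x y : ι → G}
    (hT : IsNuclearSum x y T) :
    HasSum (fun j => (V j).adjoint ∘L T ∘L V j) (∑' p : ι × κ,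
      InnerProductSpace.rankOne ℂ ((V p.2).adjoint (x p.1)) ((V p.2).adjoint (y p.1))) := by
  have hsum := (isNuclearSum_tsum_rankOne (𝕜 := ℂ) (hV.summable_norm_mul_norm hT.1)).hasSum_rankOne
  refine ((Equiv.prodComm κ ι).hasSum_iff.2 hsum).prod_fiberwise fun j => ?_
  refine (hT.hasSum_rankOne.mapL (ContinuousLinearMap.compL ℂ F G F (V j).adjoint ∘L
    (ContinuousLinearMap.compL ℂ F G G).flip (V j))).congr_fun fun i => ?_
  exact (adjoint_comp_rankOne_comp (V j) (x i) (y i)).symm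

theorem IsNuclearSum.partialTrace (hV : ResolvesIdentity V) {x y : ι → G}
    (hT : IsNuclearSum x y T) :
    IsNuclearSum (fun p : ι × κ => (V p.2).adjoint (x p.1)) (fun p => (V p.2).adjoint (y p.1))
      (partialTrace V T) := by
  rw [QuantumThermal.partialTrace, (hT.hasSum_adjoint_comp_comp hV).tsum_eq]
  exact isNuclearSum_tsum_rankOne (hV.summable_norm_mul_norm hT.1)

theorem IsTraceClass.partialTrace (hV : ResolvesIdentity V) (hT : IsTraceClass T) :
    IsTraceClass (partialTrace V T) := by
  obtain ⟨x, y, hT⟩ := hT.exists_isNuclearSum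
  exact (hT.partialTrace hV).isTraceClass

theorem trace_partialTrace (hV : ResolvesIdentity V) (hT : IsTraceClass T) :
    trace (partialTrace V T) = trace T := by
  obtain ⟨x, y, hT⟩ := hT.exists_isNuclearSum
  rw [(hT.partialTrace hV).trace_eq, hT.trace_eq]
  have hs : Summable fun p : ℕ × κ => ⟪(V p.2).adjoint (y p.1), (V p.2).adjoint (x p.1)⟫_ℂ :=
    Summable.of_norm_bounded (hV.summable_norm_mul_norm hT.1) fun p => by
      rw [mul_comm]
      exact norm_inner_le_norm _ _
  exact ((hs.hasSum.prod_fiberwise fun i => hV (y i) (x i)).tsum_eq).symm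

theorem hasSum_inner_partialTrace (hV : ResolvesIdentity V) (hT : IsTraceClass T) (u u' : F) :
    HasSum (fun j => ⟪V j u, T (V j u')⟫_ℂ) ⟪u, partialTrace V T u'⟫_ℂ := by
  obtain ⟨x, y, hT⟩ := hT.exists_isNuclearSum
  have hsum := (hT.hasSum_adjoint_comp_comp hV).summable.hasSum.mapL
    (innerSL ℂ u ∘L ContinuousLinearMap.apply ℂ F u')
  simpa [ContinuousLinearMap.adjoint_inner_right, partialTrace] using hsum

theorem IsDensityOperator.partialTrace (hV : ResolvesIdentity V) {ρ : G →L[ℂ] G}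
    (hρ : IsDensityOperator ρ) : IsDensityOperator (partialTrace V ρ) := by
  refine isDensityOperator_of_trace_eq_one ?_ (hρ.isTraceClass.partialTrace hV) ?_
  · refine nonneg_iff_forall_inner_nonneg.2 fun u => ?_
    exact (hasSum_inner_partialTrace hV hρ.isTraceClass u u).nonneg
      fun j => nonneg_iff_forall_inner_nonneg.1 hρ.nonneg (V j u)
  · rw [trace_partialTrace hV hρ.isTraceClass, hρ.trace_eq_one]

variable {EA EB : Type*} [NormedAddCommGroup EA] [InnerProductSpace ℂ EA] [CompleteSpace EA]
  [NormedAddCommGroup EB] [InnerProductSpace ℂ EB] [CompleteSpace EB]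

theorem resolvesIdentity_tmulRight (b : HilbertBasis κ ℂ EB) :
    ResolvesIdentity fun j => tmulRight (EA := EA) (b j) := by
  intro x y
  have hsum := (tensorHilbertBasis (basis EA) b).hasSum_inner_mul_inner x y
  refine ((Equiv.prodComm _ _).hasSum_iff.2 hsum).prod_fiberwise fun j => ?_
  simpa [ContinuousLinearMap.adjoint_inner_right, ContinuousLinearMap.adjoint_inner_left,
    tensorHilbertBasis_apply, tmulRight_apply] using (basis EA).hasSum_inner_mul_inner
      ((tmulRight (b j)).adjoint x) ((tmulRight (b j)).adjoint y)

theorem resolvesIdentity_tmulLeft (a : HilbertBasis κ ℂ EA) :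
    ResolvesIdentity fun i => tmulLeft (EB := EB) (a i) := by
  intro x y
  have hsum := (tensorHilbertBasis a (basis EB)).hasSum_inner_mul_inner x y
  refine hsum.prod_fiberwise fun i => ?_
  simpa [ContinuousLinearMap.adjoint_inner_right, ContinuousLinearMap.adjoint_inner_left,
    tensorHilbertBasis_apply, tmulLeft_apply] using (basis EB).hasSum_inner_mul_inner
      ((tmulLeft (a i)).adjoint x) ((tmulLeft (a i)).adjoint y)

theorem traceOutRight_eq_partialTrace (T : HilbertTensor EA EB →L[ℂ] HilbertTensor EA EB) :
    traceOutRight T = partialTrace (fun j => tmulRight (basis EB j)) T := rfl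

theorem traceOutLeft_eq_partialTrace (T : HilbertTensor EA EB →L[ℂ] HilbertTensor EA EB) :
    traceOutLeft T = partialTrace (fun i => tmulLeft (basis EA i)) T := rfl

variable {ρ : HilbertTensor EA EB →L[ℂ] HilbertTensor EA EB}

theorem IsDensityOperator.traceOutRight (hρ : IsDensityOperator ρ) :
    IsDensityOperator (traceOutRight ρ) :=
  hρ.partialTrace (resolvesIdentity_tmulRight (basis EB))

theorem IsDensityOperator.traceOutLeft (hρ : IsDensityOperator ρ) :
    IsDensityOperator (traceOutLeft ρ) :=
  hρ.partialTrace (resolvesIdentity_tmulLeft (basis EA))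

end PartialTrace

section Eigenvectors

universe u v

theorem exists_continuousOn_leftInvOn {X Y : Type*} [TopologicalSpace X] [TopologicalSpace Y]
    [T2Space Y] [Nonempty X] {K : Set X} {f : X → Y} (hK : IsCompact K) (hf : ContinuousOn f K)
    (hinj : Set.InjOn f K) : ∃ g : Y → X, ContinuousOn g (f '' K) ∧ Set.LeftInvOn g f K := by
  have hleft : Set.LeftInvOn (Function.invFunOn f K) f K := hinj.leftInvOn_invFunOn
  refine ⟨_, continuousOn_iff_isClosed.2 fun t ht => ?_, hleft⟩
  refine ⟨f '' (K ∩ t),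
    ((hK.inter_right ht).image_of_continuousOn (hf.mono Set.inter_subset_left)).isClosed, ?_⟩
  ext y
  constructor
  · rintro ⟨hy, x, hx, rfl⟩
    rw [Set.mem_preimage, hleft hx] at hy
    exact ⟨⟨x, ⟨hx, hy⟩, rfl⟩, x, hx, rfl⟩
  · rintro ⟨⟨x, ⟨hx, hxt⟩, rfl⟩, hy⟩
    exact ⟨by rwa [Set.mem_preimage, hleft hx], hy⟩

theorem exists_hilbertBasis_mem_of_orthogonalFamily {𝕜 : Type*} {E : Type u} {α : Type v}
    [RCLike 𝕜] [NormedAddCommGroup E] [InnerProductSpace 𝕜 E] [CompleteSpace E]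
    {V : α → Submodule 𝕜 E} [∀ a, CompleteSpace (V a)]
    (hV : OrthogonalFamily 𝕜 (fun a => V a) fun a => (V a).subtypeₗᵢ) (htop : (⨆ a, V a)ᗮ = ⊥) :
    ∃ (ι : Type (max u v)) (b : HilbertBasis ι 𝕜 E) (c : ι → α), ∀ i, b i ∈ V (c i) := by
  choose w b _ using fun a => exists_hilbertBasis 𝕜 (V a)
  have horth : Orthonormal 𝕜 fun p : Σ a, w a => ((b p.1 p.2 : V p.1) : E) :=
    hV.orthonormal_sigma_orthonormal fun a => (b a).orthonormal
  have hbot : (Submodule.span 𝕜 (Set.range fun p : Σ a, w a => ((b p.1 p.2 : V p.1) : E)))ᗮ =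
      ⊥ := by
    rw [Submodule.eq_bot_iff]
    intro x hx
    have hx' : x ∈ (⨆ a, V a)ᗮ := by
      rw [← Submodule.iInf_orthogonal, Submodule.mem_iInf]
      intro a
      rw [← Submodule.orthogonalProjectionOnto_eq_zero_iff]
      refine eq_of_forall_inner_hilbertBasis_eq (b a) fun i => ?_
      rw [Submodule.inner_orthogonalProjectionOnto_eq_of_mem_left, inner_zero_right]
      exact hx _ (Submodule.subset_span ⟨⟨a, i⟩, rfl⟩)
    rwa [htop, Submodule.mem_bot] at hx'
  refine ⟨_, HilbertBasis.mkOfOrthogonalEqBot horth hbot, Sigma.fst, fun p => ?_⟩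
  rw [HilbertBasis.coe_mkOfOrthogonalEqBot]
  exact (b p.1 p.2).2

variable {E : Type u} [NormedAddCommGroup E] [InnerProductSpace ℂ E] {ι : Type*}

/-- The bounded operator `T` is diagonal in the Hilbert basis `b`, with real eigenvalues `l`. -/
def IsDiagonal (b : HilbertBasis ι ℂ E) (l : ι → ℝ) (T : E →L[ℂ] E) : Prop :=
  ∀ i, T (b i) = (l i : ℂ) • b i

theorem IsDiagonal.inner_apply {b : HilbertBasis ι ℂ E} {l : ι → ℝ} {T : E →L[ℂ] E}
    (h : IsDiagonal b l T) (i : ι) : ⟪b i, T (b i)⟫_ℂ = l i := by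
  rw [h i, inner_smul_right, inner_self_eq_norm_sq_to_K, b.orthonormal.1 i]
  simp

theorem mem_spectrum_of_apply_eq_smul {a : E →L[ℂ] E} {v : E} (hv : v ≠ 0) {l : ℝ}
    (h : a v = (l : ℂ) • v) : l ∈ spectrum ℝ a := by
  rw [spectrum.mem_iff]
  rintro ⟨w, hw⟩
  have hker : (w : E →L[ℂ] E) v = 0 := by
    rw [hw, sub_apply, h, Algebra.algebraMap_eq_smul_one]
    simp
  apply hv
  have hinv : (↑w⁻¹ * ↑w : E →L[ℂ] E) v = v := by rw [Units.inv_mul, one_apply_eq_self]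
  rw [← hinv, mul_apply_eq_comp, hker, map_zero]

variable [CompleteSpace E]

theorem exists_isDiagonal {T : E →L[ℂ] E} (hT : IsSelfAdjoint T) (hc : IsCompactOperator T) :
    ∃ (ι : Type u) (b : HilbertBasis ι ℂ E) (l : ι → ℝ), IsDiagonal b l T := by
  have hsymm : (T : E →ₗ[ℂ] E).IsSymmetric := hT.isSymmetric
  have hcomplete (μ : ℂ) : CompleteSpace (Module.End.eigenspace (T : E →ₗ[ℂ] E) μ) := by
    have : (Module.End.eigenspace (T : E →ₗ[ℂ] E) μ : Set E) = {x | T x = μ • x} := by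
      ext x
      simp
    have hclosed : IsClosed (Module.End.eigenspace (T : E →ₗ[ℂ] E) μ : Set E) :=
      this ▸ isClosed_eq (by fun_prop) (by fun_prop)
    exact hclosed.completeSpace_coe
  obtain ⟨ι, b, μ, hb⟩ := exists_hilbertBasis_mem_of_orthogonalFamily
    hsymm.orthogonalFamily_eigenspaces
    (ContinuousLinearMap.orthogonalComplement_iSup_eigenspaces_eq_bot hc hsymm)
  refine ⟨ι, b, fun i => (μ i).re, fun i => ?_⟩
  have hreal : (starRingEnd ℂ) (μ i) = μ i := hsymm.conj_eigenvalue_eq_self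
    (Module.End.hasEigenvalue_of_hasEigenvector ⟨hb i, b.orthonormal.ne_zero i⟩)
  rw [Complex.conj_eq_iff_re.1 hreal]
  exact Module.End.mem_eigenspace_iff.1 (hb i)

theorem cfc_apply_of_apply_eq_smul {a : E →L[ℂ] E} (ha : IsSelfAdjoint a) {v : E} {l : ℝ}
    (h : a v = (l : ℂ) • v) {f : ℝ → ℝ} (hf : ContinuousOn f (spectrum ℝ a)) :
    cfc f a v = (f l : ℂ) • v := by
  by_cases hv : v = 0
  · simp [hv]
  have hl := mem_spectrum_of_apply_eq_smul hv h
  rw [cfc_apply f a ha hf]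
  suffices H : ∀ g : C(spectrum ℝ a, ℝ), cfcHom ha g v = (g ⟨l, hl⟩ : ℂ) • v from H _
  intro g
  have : CompactSpace (spectrum ℝ a) := isCompact_iff_compactSpace.1
    (ContinuousFunctionalCalculus.isCompact_spectrum a)
  induction g using ContinuousMap.induction_on_of_compact with
  | const r =>
    have : cfcHom ha (ContinuousMap.const _ r) = algebraMap ℝ (E →L[ℂ] E) r :=
      AlgHomClass.commutes (cfcHom ha) r
    rw [this, Algebra.algebraMap_eq_smul_one]
    simp
  | id => rw [cfcHom_id ha, h]; rfl
  | star_id => rw [map_star, cfcHom_id ha, ha.star_eq, h]; rfl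
  | add f g hf hg => rw [map_add, add_apply, hf, hg, ← add_smul]; simp
  | mul f g hf hg =>
    rw [map_mul, mul_apply_eq_comp, hg, map_smul, hf, smul_smul]
    simp [mul_comm]
  | frequently g hg =>
    have hclosed : IsClosed {g : C(spectrum ℝ a, ℝ) | cfcHom ha g v = (g ⟨l, hl⟩ : ℂ) • v} :=
      isClosed_eq
        ((ContinuousLinearMap.apply ℂ E v).continuous.comp (cfcHom_continuous ha))
        ((Complex.continuous_ofReal.comp (continuous_eval_const _)).smul continuous_const)
    exact hclosed.closure_eq.subset (mem_closure_iff_frequently.2 hg)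

theorem exists_apply_eq_smul_of_cfc_apply_eq_smul {a : E →L[ℂ] E} (ha : IsSelfAdjoint a)
    {f : ℝ → ℝ} (hf : ContinuousOn f (spectrum ℝ a)) (hinj : Set.InjOn f (spectrum ℝ a)) {v : E}
    (hv : v ≠ 0) {t : ℝ} (h : cfc f a v = (t : ℂ) • v) :
    ∃ r ∈ spectrum ℝ a, f r = t ∧ a v = (r : ℂ) • v := by
  obtain ⟨g, hg, hgf⟩ := exists_continuousOn_leftInvOn
    (ContinuousFunctionalCalculus.isCompact_spectrum (R := ℝ) a) hf hinj
  have hspec : spectrum ℝ (cfc f a) = f '' spectrum ℝ a := cfc_map_spectrum f a ha hf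
  obtain ⟨r, hr, rfl⟩ : t ∈ f '' spectrum ℝ a := hspec ▸ mem_spectrum_of_apply_eq_smul hv h
  have hcomp : cfc g (cfc f a) = a := by
    rw [← cfc_comp g f a ha hg hf, cfc_congr hgf.eqOn, cfc_id ℝ a ha]
  refine ⟨r, hr, rfl, ?_⟩
  rw [← hgf hr]
  conv_lhs => rw [← hcomp]
  exact cfc_apply_of_apply_eq_smul (cfc_predicate f a) h (hspec ▸ hg)

end Eigenvectors

section SymmetricOperators

variable {E : Type*} [NormedAddCommGroup E] [InnerProductSpace ℂ E] {S T : E →ₗ.[ℂ] E}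

theorem isSymmetric_iff_forall_mem_graph :
    IsSymmetric T ↔ ∀ p ∈ T.graph, ∀ q ∈ T.graph, ⟪p.2, q.1⟫_ℂ = ⟪p.1, q.2⟫_ℂ := by
  refine ⟨fun h p hp q hq => ?_, fun h x y => h _ (T.mem_graph x) _ (T.mem_graph y)⟩
  obtain ⟨x, hx, hx'⟩ := (LinearPMap.mem_graph_iff _).1 hp
  obtain ⟨y, hy, hy'⟩ := (LinearPMap.mem_graph_iff _).1 hq
  rw [← hx, ← hx', ← hy, ← hy', h]

theorem IsSymmetric.mono (hT : IsSymmetric T) (hle : S ≤ T) : IsSymmetric S :=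
  isSymmetric_iff_forall_mem_graph.2 fun p hp q hq =>
    isSymmetric_iff_forall_mem_graph.1 hT p (LinearPMap.le_graph_of_le hle hp) q
      (LinearPMap.le_graph_of_le hle hq)

theorem IsSymmetric.add (hS : IsSymmetric S) (hT : IsSymmetric T) : IsSymmetric (S + T) := by
  intro x y
  rw [LinearPMap.add_apply, LinearPMap.add_apply, inner_add_left, inner_add_right]
  exact congr_arg₂ (· + ·) (hS ⟨x, x.2.1⟩ ⟨y, y.2.1⟩) (hT ⟨x, x.2.2⟩ ⟨y, y.2.2⟩)

theorem IsSymmetric.of_add (hS : IsSymmetric S) (hST : IsSymmetric (S + T))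
    (hle : T.domain ≤ S.domain) : IsSymmetric T := by
  intro x y
  have hadd := hST ⟨x, hle x.2, x.2⟩ ⟨y, hle y.2, y.2⟩
  rw [LinearPMap.add_apply, LinearPMap.add_apply, inner_add_left, inner_add_right] at hadd
  exact add_left_cancel ((congr_arg (· + _) (hS ⟨x, hle x.2⟩ ⟨y, hle y.2⟩)).symm.trans hadd)

variable [CompleteSpace E] {H : E →ₗ.[ℂ] E}

theorem mem_graph_iff_of_isSelfAdjoint (hH : IsSelfAdjoint H) {p : E × E} :
    p ∈ H.graph ↔ ∀ q ∈ H.graph, ⟪q.2, p.1⟫_ℂ = ⟪q.1, p.2⟫_ℂ := by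
  have hadjoint := LinearPMap.adjoint_graph_eq_graph_adjoint hH.dense_domain
  rw [LinearPMap.isSelfAdjoint_def.1 hH] at hadjoint
  conv_lhs => rw [hadjoint]
  simp only [Submodule.mem_adjoint_iff, Prod.forall, sub_eq_zero]

theorem isSymmetric_of_isSelfAdjoint (hH : IsSelfAdjoint H) : IsSymmetric H :=
  isSymmetric_iff_forall_mem_graph.2 fun p hp _ hq => (mem_graph_iff_of_isSelfAdjoint hH).1 hq p hp

end SymmetricOperators

section Resolvent

variable {E : Type*} [NormedAddCommGroup E] [InnerProductSpace ℂ E] {H : E →ₗ.[ℂ] E} {c z : ℝ}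

/-- The operator `H - z`, as a bounded operator on the graph of `H`. -/
def graphSub (H : E →ₗ.[ℂ] E) (z : ℝ) : H.graph →L[ℂ] E :=
  (ContinuousLinearMap.snd ℂ E E - (z : ℂ) • ContinuousLinearMap.fst ℂ E E) ∘L H.graph.subtypeL

theorem graphSub_apply (p : H.graph) : graphSub H z p = (p : E × E).2 - (z : ℂ) • (p : E × E).1 :=
  rfl

theorem sub_mul_norm_sq_le_re_inner
    (hc : ∀ x : H.domain, c * ‖(x : E)‖ ^ 2 ≤ (⟪(x : E), H x⟫_ℂ).re) (p : H.graph) :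
    (c - z) * ‖(p : E × E).1‖ ^ 2 ≤ (⟪(p : E × E).1, graphSub H z p⟫_ℂ).re := by
  obtain ⟨x, hx, hHx⟩ := (LinearPMap.mem_graph_iff _).1 p.2
  have hself : (⟪(p : E × E).1, (p : E × E).1⟫_ℂ).re = ‖(p : E × E).1‖ ^ 2 :=
    inner_self_eq_norm_sq (𝕜 := ℂ) _
  have hbound := hc x
  rw [hx, hHx] at hbound
  rw [graphSub_apply, inner_sub_right, inner_smul_right, Complex.sub_re, Complex.re_ofReal_mul,
    hself]
  linarith

theorem sub_mul_norm_le_norm_graphSub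
    (hc : ∀ x : H.domain, c * ‖(x : E)‖ ^ 2 ≤ (⟪(x : E), H x⟫_ℂ).re) (p : H.graph) :
    (c - z) * ‖(p : E × E).1‖ ≤ ‖graphSub H z p‖ := by
  rcases (norm_nonneg (p : E × E).1).eq_or_lt with h0 | hpos
  · rw [← h0, mul_zero]
    exact norm_nonneg _
  · refine le_of_mul_le_mul_left ?_ hpos
    calc ‖(p : E × E).1‖ * ((c - z) * ‖(p : E × E).1‖)
        = (c - z) * ‖(p : E × E).1‖ ^ 2 := by ring
      _ ≤ (⟪(p : E × E).1, graphSub H z p⟫_ℂ).re := sub_mul_norm_sq_le_re_inner hc p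
      _ ≤ ‖(p : E × E).1‖ * ‖graphSub H z p‖ :=
        (Complex.re_le_norm _).trans (norm_inner_le_norm _ _)

theorem exists_antilipschitzWith_graphSub
    (hc : ∀ x : H.domain, c * ‖(x : E)‖ ^ 2 ≤ (⟪(x : E), H x⟫_ℂ).re) (hz : z < c) :
    ∃ K, AntilipschitzWith K (graphSub H z) := by
  have hcz : 0 < c - z := sub_pos.2 hz
  have hbound (p : H.graph) : ‖p‖ ≤ ((c - z)⁻¹ + (1 + |z| * (c - z)⁻¹)) * ‖graphSub H z p‖ := by
    have hfst : ‖(p : E × E).1‖ ≤ (c - z)⁻¹ * ‖graphSub H z p‖ :=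
      (le_inv_mul_iff₀ hcz).2 (sub_mul_norm_le_norm_graphSub hc p)
    have hsnd : ‖(p : E × E).2‖ ≤ (1 + |z| * (c - z)⁻¹) * ‖graphSub H z p‖ :=
      calc ‖(p : E × E).2‖ = ‖graphSub H z p + (z : ℂ) • (p : E × E).1‖ := by
            rw [graphSub_apply, sub_add_cancel]
        _ ≤ ‖graphSub H z p‖ + |z| * ‖(p : E × E).1‖ := by
            refine (norm_add_le _ _).trans_eq ?_
            rw [norm_smul, Complex.norm_real, Real.norm_eq_abs]
        _ ≤ ‖graphSub H z p‖ + |z| * ((c - z)⁻¹ * ‖graphSub H z p‖) := by gcongr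
        _ = (1 + |z| * (c - z)⁻¹) * ‖graphSub H z p‖ := by ring
    rw [Submodule.coe_norm, Prod.norm_def, add_mul]
    exact max_le (hfst.trans (le_add_of_nonneg_right (by positivity)))
      (hsnd.trans (le_add_of_nonneg_left (by positivity)))
  exact ⟨⟨_, by positivity⟩, ContinuousLinearMap.antilipschitz_of_bound _ hbound⟩

variable [CompleteSpace E]

theorem range_graphSub (hH : IsSelfAdjoint H)
    (hc : ∀ x : H.domain, c * ‖(x : E)‖ ^ 2 ≤ (⟪(x : E), H x⟫_ℂ).re) (hz : z < c) :
    (graphSub H z).range = ⊤ := by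
  have hG : IsClosed (H.graph : Set (E × E)) := hH.isClosed
  have : CompleteSpace H.graph := hG.completeSpace_coe
  obtain ⟨K, hK⟩ := exists_antilipschitzWith_graphSub hc hz
  have hclosed : IsClosed ((graphSub H z).range : Set E) :=
    hK.isClosed_range (graphSub H z).uniformContinuous
  rw [← hclosed.submodule_topologicalClosure_eq, Submodule.topologicalClosure_eq_top_iff,
    Submodule.eq_bot_iff]
  intro w hw
  have hgraph : (w, (z : ℂ) • w) ∈ H.graph := by
    refine (mem_graph_iff_of_isSelfAdjoint hH).2 fun q hq => ?_
    have horth : ⟪q.2 - (z : ℂ) • q.1, w⟫_ℂ = 0 := hw _ ⟨⟨q, hq⟩, rfl⟩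
    rw [inner_sub_left, inner_smul_left, Complex.conj_ofReal, sub_eq_zero] at horth
    rw [horth, inner_smul_right]
  have hnorm := sub_mul_norm_le_norm_graphSub (z := z) hc ⟨_, hgraph⟩
  rw [graphSub_apply, sub_self, norm_zero] at hnorm
  exact norm_le_zero_iff.1 (nonpos_of_mul_nonpos_right hnorm (sub_pos.2 hz))

theorem exists_resolvent (hH : IsSelfAdjoint H)
    (hc : ∀ x : H.domain, c * ‖(x : E)‖ ^ 2 ≤ (⟪(x : E), H x⟫_ℂ).re) (hz : z < c) :
    ∃ R : E →L[ℂ] E, ∀ x y : E, R x = y ↔ (y, x + (z : ℂ) • y) ∈ H.graph := by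
  have hG : IsClosed (H.graph : Set (E × E)) := hH.isClosed
  have : CompleteSpace H.graph := hG.completeSpace_coe
  obtain ⟨K, hK⟩ := exists_antilipschitzWith_graphSub hc hz
  let e := ContinuousLinearEquiv.ofBijective (graphSub H z)
    (LinearMap.ker_eq_bot.2 hK.injective) (range_graphSub hH hc hz)
  have he (p : H.graph) : e p = (p : E × E).2 - (z : ℂ) • (p : E × E).1 := rfl
  refine ⟨ContinuousLinearMap.fst ℂ E E ∘L H.graph.subtypeL ∘L (e.symm : E →L[ℂ] H.graph),
    fun x y => ⟨?_, fun h => ?_⟩⟩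
  · rintro rfl
    have hx : x + (z : ℂ) • (e.symm x : E × E).1 = (e.symm x : E × E).2 := by
      rw [← sub_eq_iff_eq_add.1 ((he _).symm.trans (e.apply_symm_apply x))]
    change ((e.symm x : E × E).1, x + (z : ℂ) • (e.symm x : E × E).1) ∈ H.graph
    rw [hx]
    exact (e.symm x).2
  · have hx : e ⟨_, h⟩ = x := by rw [he, add_sub_cancel_right]
    rw [← hx]
    simp

theorem resolventOp_apply_eq_iff (hH : IsSelfAdjoint H)
    (hc : ∀ x : H.domain, c * ‖(x : E)‖ ^ 2 ≤ (⟪(x : E), H x⟫_ℂ).re) (hz : z < c) (x y : E) :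
    resolventOp H z x = y ↔ (y, x + (z : ℂ) • y) ∈ H.graph := by
  have h := exists_resolvent hH hc hz
  rw [resolventOp, dif_pos h]
  exact h.choose_spec x y

theorem resolventOp_nonneg (hH : IsSelfAdjoint H)
    (hc : ∀ x : H.domain, c * ‖(x : E)‖ ^ 2 ≤ (⟪(x : E), H x⟫_ℂ).re) (hz : z < c) :
    0 ≤ resolventOp H (z : ℂ) := by
  refine nonneg_iff_forall_inner_nonneg.2 fun x => ?_
  have hgraph := (resolventOp_apply_eq_iff hH hc hz x _).1 rfl
  set y := resolventOp H (z : ℂ) x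
  have hsymm : ⟪x, y⟫_ℂ = ⟪y, x⟫_ℂ := by
    have h := (mem_graph_iff_of_isSelfAdjoint hH).1 hgraph _ hgraph
    simp only [inner_add_left, inner_add_right, inner_smul_left, inner_smul_right,
      Complex.conj_ofReal] at h
    exact add_right_cancel h
  have hre := sub_mul_norm_sq_le_re_inner (z := z) hc ⟨_, hgraph⟩
  rw [graphSub_apply, add_sub_cancel_right, ← hsymm] at hre
  refine Complex.nonneg_iff.2 ⟨le_trans ?_ hre, ?_⟩
  · exact mul_nonneg (sub_nonneg.2 hz.le) (sq_nonneg _)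
  · exact (Complex.conj_eq_iff_im.1 (by rw [inner_conj_symm, hsymm])).symm

end Resolvent

section BoltzmannWeight

variable {β : ℝ}

/-- The function of the resolvent `r = 1 / (x - m + 1)` whose value is `exp(-β x)`, extended by
`0` at `r = 0`; it defines `expNeg β H` when `m = bottom H`. -/
def boltzmannWeight (β m r : ℝ) : ℝ := if r ≤ 0 then 0 else Real.exp (-β * (r⁻¹ + m - 1))

theorem boltzmannWeight_of_pos {r : ℝ} (hr : 0 < r) (m : ℝ) :
    boltzmannWeight β m r = Real.exp (-β * (r⁻¹ + m - 1)) :=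
  if_neg hr.not_ge

theorem boltzmannWeight_zero (m : ℝ) : boltzmannWeight β m 0 = 0 := if_pos le_rfl

theorem boltzmannWeight_nonneg (m r : ℝ) : 0 ≤ boltzmannWeight β m r := by
  rw [boltzmannWeight]
  split_ifs
  exacts [le_rfl, (Real.exp_pos _).le]

theorem strictMonoOn_boltzmannWeight (hβ : 0 < β) (m : ℝ) :
    StrictMonoOn (boltzmannWeight β m) (Set.Ici 0) := by
  intro r hr s _ hrs
  have hs : 0 < s := (Set.mem_Ici.1 hr).trans_lt hrs
  rw [boltzmannWeight_of_pos hs]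
  rcases (Set.mem_Ici.1 hr).eq_or_lt with rfl | hr
  · rw [boltzmannWeight_zero]
    exact Real.exp_pos _
  · rw [boltzmannWeight_of_pos hr, Real.exp_lt_exp, neg_mul, neg_mul, neg_lt_neg_iff]
    gcongr

theorem tendsto_exp_neg_mul_inv_nhdsGT_zero (hβ : 0 < β) (m : ℝ) :
    Filter.Tendsto (fun r : ℝ => Real.exp (-β * (r⁻¹ + m - 1))) (nhdsWithin 0 (Set.Ioi 0))
      (nhds 0) := by
  refine Real.tendsto_exp_atBot.comp (Filter.Tendsto.const_mul_atTop_of_neg (neg_lt_zero.2 hβ) ?_)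
  simp only [add_sub_assoc]
  exact Filter.tendsto_atTop_add_const_right _ _ tendsto_inv_nhdsGT_zero

theorem continuousOn_boltzmannWeight (hβ : 0 < β) (m : ℝ) :
    ContinuousOn (boltzmannWeight β m) (Set.Ici 0) := by
  intro r hr
  rcases (Set.mem_Ici.1 hr).eq_or_lt with rfl | hr
  · rw [← continuousWithinAt_Ioi_iff_Ici, ContinuousWithinAt, boltzmannWeight_zero]
    refine (tendsto_exp_neg_mul_inv_nhdsGT_zero hβ m).congr' ?_
    filter_upwards [self_mem_nhdsWithin] with x hx
    rw [boltzmannWeight_of_pos hx]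
  · have hcont : ContinuousAt (fun r : ℝ => Real.exp (-β * (r⁻¹ + m - 1))) r := by
      have := hr.ne'
      fun_prop (disch := assumption)
    refine (hcont.congr ?_).continuousWithinAt
    filter_upwards [lt_mem_nhds hr] with x hx
    rw [boltzmannWeight_of_pos hx]

end BoltzmannWeight

section EnergyBasis

universe u

variable {E : Type u} [NormedAddCommGroup E] [InnerProductSpace ℂ E] {H : E →ₗ.[ℂ] E}

theorem IsBoundedBelow.bottom_mul_le (hb : IsBoundedBelow H) (x : H.domain) :
    bottom H * ‖(x : E)‖ ^ 2 ≤ (⟪(x : E), H x⟫_ℂ).re := by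
  obtain ⟨c, hc⟩ := hb
  by_cases hx : (x : E) = 0
  · simp [hx]
  have hx' : ‖(x : E)‖ ≠ 0 := norm_ne_zero_iff.2 hx
  have hbdd : BddBelow {r | ∃ x : H.domain, ‖(x : E)‖ = 1 ∧ r = (⟪(x : E), H x⟫_ℂ).re} := by
    refine ⟨c, ?_⟩
    rintro r ⟨y, hy, rfl⟩
    simpa [hy] using hc y
  have hnormalized : bottom H ≤ ‖(x : E)‖⁻¹ * ‖(x : E)‖⁻¹ * (⟪(x : E), H x⟫_ℂ).re := by
    refine csInf_le hbdd ⟨((‖(x : E)‖⁻¹ : ℝ) : ℂ) • x, ?_, ?_⟩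
    · simp [norm_smul, hx']
    · rw [LinearPMap.map_smul, Submodule.coe_smul, inner_smul_left, inner_smul_right,
        Complex.conj_ofReal, ← mul_assoc, ← Complex.ofReal_mul, Complex.re_ofReal_mul]
  calc bottom H * ‖(x : E)‖ ^ 2
      ≤ ‖(x : E)‖⁻¹ * ‖(x : E)‖⁻¹ * (⟪(x : E), H x⟫_ℂ).re * ‖(x : E)‖ ^ 2 := by gcongr
    _ = (⟪(x : E), H x⟫_ℂ).re := by field_simp

/-- The Hilbert basis `φ` consists of eigenvectors of the unbounded operator `H`, with real
eigenvalues `ε`. -/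
def IsEnergyBasis {ι : Type*} (φ : HilbertBasis ι ℂ E) (ε : ι → ℝ) (H : E →ₗ.[ℂ] E) : Prop :=
  ∀ k, (φ k, (ε k : ℂ) • φ k) ∈ H.graph

variable [CompleteSpace E] {β : ℝ}

theorem expNeg_eq_cfc_boltzmannWeight (β : ℝ) (H : E →ₗ.[ℂ] E) : expNeg β H =
    cfc (boltzmannWeight β (bottom H)) (resolventOp H ((bottom H - 1 : ℝ) : ℂ)) := rfl

theorem expNeg_nonneg (β : ℝ) (H : E →ₗ.[ℂ] E) : 0 ≤ expNeg β H := by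
  rw [expNeg_eq_cfc_boltzmannWeight]
  exact cfc_nonneg fun r _ => boltzmannWeight_nonneg _ r

theorem isBoundedBelow_of_partitionFunction_lt_top (hZ : partitionFunction β H < ⊤) :
    IsBoundedBelow H := by
  by_contra hb
  simp [partitionFunction, hb] at hZ

theorem partitionFunction_eq_posTrace (hb : IsBoundedBelow H) :
    partitionFunction β H = posTrace (expNeg β H) := if_pos hb

theorem exists_mem_graph_of_expNeg_apply_eq_smul (hH : IsSelfAdjoint H) (hb : IsBoundedBelow H)
    (hβ : 0 < β) {v : E} (hv : v ≠ 0) {t : ℝ} (h : expNeg β H v = (t : ℂ) • v) :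
    ∃ ε : ℝ, t = Real.exp (-β * ε) ∧ (v, (ε : ℂ) • v) ∈ H.graph := by
  rw [expNeg_eq_cfc_boltzmannWeight] at h
  have hz : bottom H - 1 < bottom H := sub_one_lt _
  have hR_nonneg := resolventOp_nonneg hH hb.bottom_mul_le hz
  have hspec : spectrum ℝ (resolventOp H ((bottom H - 1 : ℝ) : ℂ)) ⊆ Set.Ici 0 :=
    fun r hr => spectrum_nonneg_of_nonneg hR_nonneg hr
  obtain ⟨r, hr, rfl, hrv⟩ := exists_apply_eq_smul_of_cfc_apply_eq_smul hR_nonneg.isSelfAdjoint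
    ((continuousOn_boltzmannWeight hβ _).mono hspec)
    ((strictMonoOn_boltzmannWeight hβ _).injOn.mono hspec) hv h
  rw [resolventOp_apply_eq_iff hH hb.bottom_mul_le hz] at hrv
  have hr_pos : 0 < r := by
    refine lt_of_le_of_ne (hspec hr) ?_
    rintro rfl
    rw [Complex.ofReal_zero, zero_smul, smul_zero, add_zero] at hrv
    exact hv (LinearPMap.graph_fst_eq_zero_snd H hrv rfl)
  have hr_ne : (r : ℂ) ≠ 0 := Complex.ofReal_ne_zero.2 hr_pos.ne'
  refine ⟨r⁻¹ + bottom H - 1, boltzmannWeight_of_pos hr_pos _, ?_⟩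
  convert H.graph.smul_mem (r : ℂ)⁻¹ hrv using 1
  refine Prod.ext (inv_smul_smul₀ hr_ne v).symm ?_
  rw [Prod.smul_snd, smul_add, smul_comm, inv_smul_smul₀ hr_ne, ← add_smul, add_sub_assoc,
    Complex.ofReal_add, Complex.ofReal_inv]

theorem exists_isEnergyBasis (hH : IsSelfAdjoint H) (hβ : 0 < β)
    (hZ : partitionFunction β H < ⊤) :
    ∃ (ι : Type u) (φ : HilbertBasis ι ℂ E) (ε : ι → ℝ),
      IsEnergyBasis φ ε H ∧ IsDiagonal φ (fun k => Real.exp (-β * ε k)) (expNeg β H) := by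
  have hb := isBoundedBelow_of_partitionFunction_lt_top hZ
  rw [partitionFunction_eq_posTrace hb] at hZ
  have hT := expNeg_nonneg β H
  obtain ⟨ι, φ, t, ht⟩ := exists_isDiagonal hT.isSelfAdjoint
    (isTraceClass_of_posTrace_lt_top hT hZ).isCompactOperator
  choose ε hε using fun k => exists_mem_graph_of_expNeg_apply_eq_smul hH hb hβ
    (φ.orthonormal.ne_zero k) (ht k)
  exact ⟨ι, φ, ε, fun k => (hε k).2, fun k => by rw [ht k, (hε k).1]⟩

end EnergyBasis

section Entropy

universe u

variable {E : Type u} [NormedAddCommGroup E] [InnerProductSpace ℂ E] {ι κ : Type*}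
  {b : HilbertBasis ι ℂ E} {l : ι → ℝ} {T : E →L[ℂ] E}

theorem IsDiagonal.smul (h : IsDiagonal b l T) (r : ℝ) :
    IsDiagonal b (fun i => r * l i) (r • T) := by
  intro i
  rw [smul_apply, h i, ← Complex.coe_smul, smul_smul, Complex.ofReal_mul]

variable [CompleteSpace E]

theorem IsDiagonal.cfc (h : IsDiagonal b l T) (hT : IsSelfAdjoint T) {f : ℝ → ℝ}
    (hf : ContinuousOn f (spectrum ℝ T)) : IsDiagonal b (fun i => f (l i)) (cfc f T) :=
  fun i => cfc_apply_of_apply_eq_smul hT (h i) hf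

theorem IsDiagonal.posTrace_eq (h : IsDiagonal b l T) (hT : 0 ≤ T) :
    posTrace T = ∑' i, ENNReal.ofReal (l i) := by
  simp only [posTrace_eq_tsum hT b, h.inner_apply, Complex.ofReal_re]

theorem spectrum_subset_Icc_zero_one (h0 : 0 ≤ T) (h1 : T ≤ 1) :
    spectrum ℝ T ⊆ Set.Icc 0 1 := fun r hr =>
  ⟨spectrum_nonneg_of_nonneg h0 hr, (CFC.le_one_iff (R := ℝ) T h0.isSelfAdjoint).1 h1 r hr⟩

theorem IsDiagonal.mem_Icc_zero_one (h : IsDiagonal b l T) (h0 : 0 ≤ T) (h1 : T ≤ 1) (i : ι) :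
    l i ∈ Set.Icc 0 1 :=
  spectrum_subset_Icc_zero_one h0 h1
    (mem_spectrum_of_apply_eq_smul (b.orthonormal.ne_zero i) (h i))

theorem cfc_negMulLog_nonneg (h0 : 0 ≤ T) (h1 : T ≤ 1) : 0 ≤ cfc Real.negMulLog T :=
  cfc_nonneg fun _ hr =>
    have hr' := spectrum_subset_Icc_zero_one h0 h1 hr
    Real.negMulLog_nonneg hr'.1 hr'.2

theorem IsDiagonal.entropy_eq (h : IsDiagonal b l T) (h0 : 0 ≤ T) (h1 : T ≤ 1) :
    entropy T = ∑' i, ENNReal.ofReal (Real.negMulLog (l i)) :=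
  (h.cfc h0.isSelfAdjoint Real.continuous_negMulLog.continuousOn).posTrace_eq
    (cfc_negMulLog_nonneg h0 h1)

theorem IsDensityOperator.exists_isDiagonal (hT : IsDensityOperator T) :
    ∃ (ι : Type u) (b : HilbertBasis ι ℂ E) (l : ι → ℝ), IsDiagonal b l T :=
  QuantumThermal.exists_isDiagonal hT.nonneg.isSelfAdjoint hT.isTraceClass.isCompactOperator

theorem tsum_ofReal_negMulLog_mul {p : ι → ℝ} {q : κ → ℝ} (hp : ∀ i, p i ∈ Set.Icc 0 1)
    (hq : ∀ j, q j ∈ Set.Icc 0 1) (hp1 : ∑' i, ENNReal.ofReal (p i) = 1)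
    (hq1 : ∑' j, ENNReal.ofReal (q j) = 1) :
    ∑' r : ι × κ, ENNReal.ofReal (Real.negMulLog (p r.1 * q r.2)) =
      ∑' i, ENNReal.ofReal (Real.negMulLog (p i)) +
        ∑' j, ENNReal.ofReal (Real.negMulLog (q j)) := by
  have hterm (i : ι) (j : κ) : ENNReal.ofReal (Real.negMulLog (p i * q j)) =
      ENNReal.ofReal (Real.negMulLog (p i)) * ENNReal.ofReal (q j) +
        ENNReal.ofReal (p i) * ENNReal.ofReal (Real.negMulLog (q j)) := by
    have hηp := Real.negMulLog_nonneg (hp i).1 (hp i).2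
    have hηq := Real.negMulLog_nonneg (hq j).1 (hq j).2
    rw [Real.negMulLog_mul, ENNReal.ofReal_add (mul_nonneg (hq j).1 hηp)
      (mul_nonneg (hp i).1 hηq), ENNReal.ofReal_mul (hq j).1, ENNReal.ofReal_mul (hp i).1,
      mul_comm (ENNReal.ofReal (q j))]
  rw [ENNReal.tsum_prod (f := fun i j => ENNReal.ofReal (Real.negMulLog (p i * q j)))]
  simp only [hterm, ENNReal.tsum_add, ENNReal.tsum_mul_left, ENNReal.tsum_mul_right, hp1, hq1,
    mul_one, one_mul]

theorem IsDiagonal.tensorCLM {EA EB : Type*} [NormedAddCommGroup EA] [InnerProductSpace ℂ EA]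
    [CompleteSpace EA] [NormedAddCommGroup EB] [InnerProductSpace ℂ EB] [CompleteSpace EB]
    {a : HilbertBasis ι ℂ EA} {b : HilbertBasis κ ℂ EB} {p : ι → ℝ} {q : κ → ℝ}
    {S : EA →L[ℂ] EA} {T : EB →L[ℂ] EB} (hS : IsDiagonal a p S) (hT : IsDiagonal b q T) :
    IsDiagonal (tensorHilbertBasis a b) (fun r => p r.1 * q r.2) (tensorCLM S T) := by
  intro r
  rw [tensorHilbertBasis_apply, tensorCLM_pureTensor, hS, hT, pureTensor_smul_smul,
    Complex.ofReal_mul]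

theorem IsDensityOperator.entropy_tensorCLM {EA EB : Type*} [NormedAddCommGroup EA]
    [InnerProductSpace ℂ EA] [CompleteSpace EA] [NormedAddCommGroup EB] [InnerProductSpace ℂ EB]
    [CompleteSpace EB] {ρ : EA →L[ℂ] EA} {σ : EB →L[ℂ] EB} (hρ : IsDensityOperator ρ)
    (hσ : IsDensityOperator σ) :
    entropy (QuantumThermal.tensorCLM ρ σ) = entropy ρ + entropy σ := by
  obtain ⟨ι, a, p, ha⟩ := hρ.exists_isDiagonal
  obtain ⟨κ, b, q, hb⟩ := hσ.exists_isDiagonal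
  have hρσ := hρ.tensorCLM hσ
  rw [(ha.tensorCLM hb).entropy_eq hρσ.nonneg hρσ.le_one, ha.entropy_eq hρ.nonneg hρ.le_one,
    hb.entropy_eq hσ.nonneg hσ.le_one]
  exact tsum_ofReal_negMulLog_mul (ha.mem_Icc_zero_one hρ.nonneg hρ.le_one)
    (hb.mem_Icc_zero_one hσ.nonneg hσ.le_one)
    ((ha.posTrace_eq hρ.nonneg).symm.trans hρ.posTrace_eq_one)
    ((hb.posTrace_eq hσ.nonneg).symm.trans hσ.posTrace_eq_one)

theorem negMulLog_add_le {x q : ℝ} (hx : 0 ≤ x) (hq : 0 < q) :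
    Real.negMulLog x + x ≤ -Real.log q * x + q := by
  rcases hx.eq_or_lt with rfl | hx
  · simpa using hq.le
  have hlog : x * Real.log (q / x) ≤ x * (q / x - 1) := by
    gcongr
    exact Real.log_le_sub_one_of_pos (div_pos hq hx)
  rw [Real.log_div hq.ne' hx.ne', mul_sub_one, mul_div_cancel₀ _ hx.ne'] at hlog
  rw [Real.negMulLog]
  linarith

theorem cfc_negMulLog_add_le (hT : 0 ≤ T) {q : ℝ} (hq : 0 < q) :
    cfc Real.negMulLog T + T ≤ (-Real.log q) • T + q • 1 := by
  have hsa := hT.isSelfAdjoint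
  have hle : cfc (fun x => Real.negMulLog x + x) T ≤ cfc (fun x => -Real.log q * x + q) T :=
    cfc_mono (fun x hx => negMulLog_add_le (spectrum_nonneg_of_nonneg hT hx) hq)
      (by fun_prop) (by fun_prop)
  rwa [cfc_add T Real.negMulLog fun x => x, cfc_id' ℝ T, cfc_add_const .., cfc_const_mul_id ..,
    Algebra.algebraMap_eq_smul_one] at hle

theorem IsDensityOperator.entropy_le_tsum (hT : IsDensityOperator T) (b : HilbertBasis ι ℂ E)
    {q : ι → ℝ} (hq : ∀ i, q i ∈ Set.Ioc 0 1) (hq1 : ∑' i, ENNReal.ofReal (q i) = 1) :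
    entropy T ≤ ∑' i, ENNReal.ofReal (-Real.log (q i) * (⟪b i, T (b i)⟫_ℂ).re) := by
  have hη := cfc_negMulLog_nonneg hT.nonneg hT.le_one
  have hterm (i : ι) : ENNReal.ofReal (⟪b i, _root_.cfc Real.negMulLog T (b i)⟫_ℂ).re +
      ENNReal.ofReal (⟪b i, T (b i)⟫_ℂ).re ≤
      ENNReal.ofReal (-Real.log (q i) * (⟪b i, T (b i)⟫_ℂ).re) + ENNReal.ofReal (q i) := by
    have hle := re_inner_nonneg (sub_nonneg.2 (cfc_negMulLog_add_le hT.nonneg (hq i).1)) (b i)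
    have hlog := neg_nonneg.2 (Real.log_nonpos (hq i).1.le (hq i).2)
    rw [← ENNReal.ofReal_add (re_inner_nonneg hη _) (re_inner_nonneg hT.nonneg _),
      ← ENNReal.ofReal_add (mul_nonneg hlog (re_inner_nonneg hT.nonneg _)) (hq i).1.le]
    refine ENNReal.ofReal_le_ofReal ?_
    simpa [inner_sub_right, inner_add_right, ← Complex.coe_smul, inner_smul_right,
      inner_self_eq_norm_sq_to_K, b.orthonormal.1 i, sub_nonneg] using hle
  have hsum := ENNReal.tsum_le_tsum hterm
  rw [ENNReal.tsum_add, ENNReal.tsum_add, ← posTrace_eq_tsum hη, ← posTrace_eq_tsum hT.nonneg,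
    hT.posTrace_eq_one, hq1] at hsum
  exact (ENNReal.add_le_add_iff_right ENNReal.one_ne_top).1 hsum

end Entropy

section GibbsState

universe u

variable {E : Type u} [NormedAddCommGroup E] [InnerProductSpace ℂ E] [CompleteSpace E]
  {H : E →ₗ.[ℂ] E} {β : ℝ}

theorem posTrace_smul {r : ℝ} (hr : 0 ≤ r) (T : E →L[ℂ] E) :
    posTrace (r • T) = ENNReal.ofReal r * posTrace T := by
  rw [posTrace, posTrace, ← ENNReal.tsum_mul_left]
  refine tsum_congr fun i => ?_
  rw [← ENNReal.ofReal_mul hr, smul_apply, ← Complex.coe_smul,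
    inner_smul_right, Complex.re_ofReal_mul]

theorem partitionFunction_ne_zero [Nontrivial E] (hH : IsSelfAdjoint H) (hβ : 0 < β)
    (hZ : partitionFunction β H < ⊤) : partitionFunction β H ≠ 0 := by
  obtain ⟨ι, φ, ε, -, hexp⟩ := exists_isEnergyBasis hH hβ hZ
  have : Nonempty ι := by
    by_contra hι
    obtain ⟨x, hx⟩ := exists_ne (0 : E)
    exact hx (eq_of_forall_inner_hilbertBasis_eq φ fun k => (hι ⟨k⟩).elim)
  rw [partitionFunction_eq_posTrace (isBoundedBelow_of_partitionFunction_lt_top hZ),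
    hexp.posTrace_eq (expNeg_nonneg β H), Ne, ENNReal.tsum_eq_zero, not_forall]
  exact ⟨Classical.arbitrary ι, by simp [Real.exp_pos]⟩

variable [Nontrivial E]

theorem isDensityOperator_gibbsState (hH : IsSelfAdjoint H) (hβ : 0 < β)
    (hZ : partitionFunction β H < ⊤) : IsDensityOperator (gibbsState β H) where
  nonneg := smul_nonneg (inv_nonneg.2 ENNReal.toReal_nonneg) (expNeg_nonneg β H)
  posTrace_eq_one := by
    have hZ0 := partitionFunction_ne_zero hH hβ hZ
    rw [gibbsState, posTrace_smul (inv_nonneg.2 ENNReal.toReal_nonneg),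
      ENNReal.ofReal_inv_of_pos (ENNReal.toReal_pos hZ0 hZ.ne), ENNReal.ofReal_toReal hZ.ne,
      ← partitionFunction_eq_posTrace (isBoundedBelow_of_partitionFunction_lt_top hZ),
      ENNReal.inv_mul_cancel hZ0 hZ.ne]

theorem exists_isEnergyBasis_isDiagonal_gibbsState (hH : IsSelfAdjoint H) (hβ : 0 < β)
    (hZ : partitionFunction β H < ⊤) :
    ∃ (ι : Type u) (φ : HilbertBasis ι ℂ E) (ε : ι → ℝ), IsEnergyBasis φ ε H ∧
      IsDiagonal φ (fun k => Real.exp (-(β * ε k + Real.log (partitionFunction β H).toReal)))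
        (gibbsState β H) := by
  obtain ⟨ι, φ, ε, hφ, hexp⟩ := exists_isEnergyBasis hH hβ hZ
  refine ⟨ι, φ, ε, hφ, ?_⟩
  convert hexp.smul (partitionFunction β H).toReal⁻¹ using 2 with k
  · rw [neg_add_rev, Real.exp_add, Real.exp_neg (Real.log _),
      Real.exp_log (ENNReal.toReal_pos (partitionFunction_ne_zero hH hβ hZ) hZ.ne), neg_mul]
  · rfl

end GibbsState

section WeakProduct

variable {E : Type*} [NormedAddCommGroup E] [InnerProductSpace ℂ E] {S T : E →ₗ.[ℂ] E}
  {ρ σ K L : E →L[ℂ] E}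

theorem IsProduct.productOp_eq (h : IsProduct T ρ K) : productOp T ρ = K := by
  have hex : ∃ K : E →L[ℂ] E, IsProduct T ρ K := ⟨K, h⟩
  rw [productOp, dif_pos hex]
  ext x
  exact T.mem_graph_snd_inj (hex.choose_spec x) (h x) rfl

theorem IsProduct.sub (hρ : IsProduct T ρ K) (hσ : IsProduct T σ L) :
    IsProduct T (ρ - σ) (K - L) :=
  fun x => T.graph.sub_mem (hρ x) (hσ x)

theorem HasTrace.sub (hρ : HasTrace T ρ) (hσ : HasTrace T σ) : HasTrace T (ρ - σ) := by
  obtain ⟨K, hK, hKtc⟩ := hρ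
  obtain ⟨L, hL, hLtc⟩ := hσ
  exact ⟨K - L, hK.sub hL, hKtc.sub hLtc⟩

theorem HasTrace.trace_productOp_sub [CompleteSpace E] (hρ : HasTrace T ρ) (hσ : HasTrace T σ) :
    trace (productOp T (ρ - σ)) = trace (productOp T ρ) - trace (productOp T σ) := by
  obtain ⟨K, hK, hKtc⟩ := hρ
  obtain ⟨L, hL, hLtc⟩ := hσ
  rw [(hK.sub hL).productOp_eq, hK.productOp_eq, hL.productOp_eq, trace_sub hKtc hLtc]

/-- The identity `K = T* ρ` in the weak sense `⟪T z, ρ x⟫ = ⟪z, K x⟫`, for `z` in the domain of `T`.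
For symmetric `T` it follows from `K = T.closure ρ`; unlike the latter it is inherited by sums of
operators and by partial traces. -/
def IsWeakProduct (T : E →ₗ.[ℂ] E) (ρ K : E →L[ℂ] E) : Prop :=
  ∀ p ∈ T.graph, ∀ x, ⟪p.2, ρ x⟫_ℂ = ⟪p.1, K x⟫_ℂ

-- Also correct for `T` that is not closable, since then `T.closure = T` by convention.
theorem graph_closure_subset (T : E →ₗ.[ℂ] E) :
    (T.closure.graph : Set (E × E)) ⊆ closure (T.graph : Set (E × E)) := by
  by_cases h : T.IsClosable
  · rw [← h.graph_closure_eq_closure_graph]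
    exact subset_rfl
  · rw [LinearPMap.closure_def' h]
    exact subset_closure

theorem IsWeakProduct.closure (h : IsWeakProduct T ρ K) : IsWeakProduct T.closure ρ K := by
  intro p hp x
  have hclosed : IsClosed {p : E × E | ⟪p.2, ρ x⟫_ℂ = ⟪p.1, K x⟫_ℂ} :=
    isClosed_eq (by fun_prop) (by fun_prop)
  exact closure_minimal (fun p hp => h p hp x) hclosed (graph_closure_subset T hp)

theorem IsProduct.isWeakProduct (hT : IsSymmetric T) (h : IsProduct T.closure ρ K) :
    IsWeakProduct T ρ K := by
  intro p hp x
  have hclosed : IsClosed {q : E × E | ⟪p.2, q.1⟫_ℂ = ⟪p.1, q.2⟫_ℂ} :=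
    isClosed_eq (by fun_prop) (by fun_prop)
  exact closure_minimal (isSymmetric_iff_forall_mem_graph.1 hT p hp) hclosed
    (graph_closure_subset T (h x))

theorem IsWeakProduct.add (hS : IsWeakProduct S ρ K) (hT : IsWeakProduct T ρ L) :
    IsWeakProduct (S + T) ρ (K + L) := by
  intro p hp x
  obtain ⟨⟨z, hzS, hzT⟩, hz, hp⟩ := (LinearPMap.mem_graph_iff _).1 hp
  rw [← hp, ← hz, LinearPMap.add_apply, inner_add_left, add_apply, inner_add_right]
  exact congr_arg₂ (· + ·) (hS _ (S.mem_graph ⟨z, hzS⟩) x) (hT _ (T.mem_graph ⟨z, hzT⟩) x)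

theorem isWeakProduct_of_graph_eq_span {s : Set (E × E)} (hs : T.graph = Submodule.span ℂ s)
    (h : ∀ p ∈ s, ∀ x, ⟪p.2, ρ x⟫_ℂ = ⟪p.1, K x⟫_ℂ) : IsWeakProduct T ρ K := by
  intro p hp x
  rw [hs] at hp
  induction hp using Submodule.span_induction with
  | mem p hp => exact h p hp x
  | zero => simp
  | add p q _ _ hp hq =>
    rw [Prod.fst_add, Prod.snd_add, inner_add_left, inner_add_left, hp, hq]
  | smul c p _ hp => rw [Prod.smul_fst, Prod.smul_snd, inner_smul_left, inner_smul_left, hp]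

theorem isSymmetric_of_graph_eq_span {s : Set (E × E)} (hs : T.graph = Submodule.span ℂ s)
    (h : ∀ p ∈ s, ∀ q ∈ s, ⟪p.2, q.1⟫_ℂ = ⟪p.1, q.2⟫_ℂ) : IsSymmetric T := by
  rw [isSymmetric_iff_forall_mem_graph, hs]
  intro p hp q hq
  induction hp, hq using Submodule.span_induction₂ with
  | mem_mem p q hp hq => exact h p hp q hq
  | zero_left => simp
  | zero_right => simp
  | add_left p q r _ _ _ hp hq => simp only [Prod.fst_add, Prod.snd_add, inner_add_left, hp, hq]
  | add_right p q r _ _ _ hp hq => simp only [Prod.fst_add, Prod.snd_add, inner_add_right, hp, hq]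
  | smul_left c p q _ _ hp => simp only [Prod.smul_fst, Prod.smul_snd, inner_smul_left, hp]
  | smul_right c p q _ _ hp => simp only [Prod.smul_fst, Prod.smul_snd, inner_smul_right, hp]

theorem isSymmetric_id_toPMap_top : IsSymmetric ((LinearMap.id : E →ₗ[ℂ] E).toPMap ⊤) :=
  fun _ _ => rfl

theorem isWeakProduct_id_toPMap_top (ρ : E →L[ℂ] E) :
    IsWeakProduct ((LinearMap.id : E →ₗ[ℂ] E).toPMap ⊤) ρ ρ := by
  intro p hp x
  obtain ⟨z, hz, hz'⟩ := (LinearPMap.mem_graph_iff _).1 hp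
  rw [← hz, ← hz']
  rfl

end WeakProduct

section TensorPMap

variable {EA EB : Type*} [NormedAddCommGroup EA] [InnerProductSpace ℂ EA]
  [NormedAddCommGroup EB] [InnerProductSpace ℂ EB] {S : EA →ₗ.[ℂ] EA} {T : EB →ₗ.[ℂ] EB}

theorem tensorPMap_graph_eq_span (S : EA →ₗ.[ℂ] EA) (T : EB →ₗ.[ℂ] EB) :
    (tensorPMap S T).graph = Submodule.span ℂ (Set.range fun p : S.domain × T.domain =>
      (pureTensor (p.1 : EA) (p.2 : EB), pureTensor (S p.1) (T p.2))) := by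
  let e := LinearEquiv.ofInjective (domainEmbedding S.domain T.domain)
    (domainEmbedding_injective S.domain T.domain)
  let f : S.domain ⊗[ℂ] T.domain →ₗ[ℂ] HilbertTensor EA EB × HilbertTensor EA EB :=
    (tensorPMap S T).domain.subtype.prod (tensorPMap S T).toFun ∘ₗ e.toLinearMap
  have hf (a : S.domain) (b : T.domain) :
      f (a ⊗ₜ b) = (pureTensor (a : EA) (b : EB), pureTensor (S a) (T b)) := by
    refine Prod.ext rfl ?_
    change ((TensorProduct.map S.toFun T.toFun (e.symm (e (a ⊗ₜ b))) : EA ⊗[ℂ] EB) :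
      HilbertTensor EA EB) = _
    rw [e.symm_apply_apply]
    rfl
  have hgraph : (tensorPMap S T).graph = LinearMap.range f := by
    ext p
    rw [LinearPMap.mem_graph_iff]
    exact e.surjective.exists.trans (exists_congr fun t =>
      (Prod.ext_iff (x := f t) (y := p)).symm)
  rw [hgraph, ← Submodule.map_top, ← TensorProduct.span_tmul_eq_top, Submodule.map_span]
  congr 1
  ext p
  simp [hf]

theorem pureTensor_mem_tensorPMap_graph {p : EA × EA} {q : EB × EB} (hp : p ∈ S.graph)
    (hq : q ∈ T.graph) : (pureTensor p.1 q.1, pureTensor p.2 q.2) ∈ (tensorPMap S T).graph := by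
  obtain ⟨a, ha, ha'⟩ := (LinearPMap.mem_graph_iff _).1 hp
  obtain ⟨b, hb, hb'⟩ := (LinearPMap.mem_graph_iff _).1 hq
  rw [tensorPMap_graph_eq_span, ← ha, ← ha', ← hb, ← hb']
  exact Submodule.subset_span ⟨(a, b), rfl⟩

theorem tmulRight_mem_tensorOne_graph (v : EB) {p : EA × EA} (hp : p ∈ S.graph) :
    (tmulRight v p.1, tmulRight v p.2) ∈ (tensorOne (EB := EB) S).graph :=
  pureTensor_mem_tensorPMap_graph (q := (v, v)) hp (LinearPMap.mem_graph _ ⟨v, Submodule.mem_top⟩)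

theorem tmulLeft_mem_oneTensor_graph (u : EA) {q : EB × EB} (hq : q ∈ T.graph) :
    (tmulLeft u q.1, tmulLeft u q.2) ∈ (oneTensor (EA := EA) T).graph :=
  pureTensor_mem_tensorPMap_graph (p := (u, u)) (LinearPMap.mem_graph _ ⟨u, Submodule.mem_top⟩) hq

theorem IsSymmetric.tensorPMap (hS : IsSymmetric S) (hT : IsSymmetric T) :
    IsSymmetric (tensorPMap S T) := by
  refine isSymmetric_of_graph_eq_span (tensorPMap_graph_eq_span S T) ?_
  rintro _ ⟨⟨a, b⟩, rfl⟩ _ ⟨⟨a', b'⟩, rfl⟩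
  rw [inner_pureTensor, inner_pureTensor, hS a a', hT b b']

theorem IsWeakProduct.tensorPMap {ρ K : EA →L[ℂ] EA} {σ L : EB →L[ℂ] EB}
    (hS : IsWeakProduct S ρ K) (hT : IsWeakProduct T σ L) :
    IsWeakProduct (tensorPMap S T) (tensorCLM ρ σ) (tensorCLM K L) := by
  refine isWeakProduct_of_graph_eq_span (tensorPMap_graph_eq_span S T) ?_
  rintro _ ⟨⟨a, b⟩, rfl⟩ x
  have hpure (u : EA) (v : EB) :
      innerSL ℂ (pureTensor (S a) (T b)) (tensorCLM ρ σ (pureTensor u v)) =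
        innerSL ℂ (pureTensor (a : EA) (b : EB)) (tensorCLM K L (pureTensor u v)) := by
    simp only [innerSL_apply_apply, tensorCLM_pureTensor, inner_pureTensor,
      hS _ (S.mem_graph a), hT _ (T.mem_graph b)]
  exact congr_arg (fun f : _ →L[ℂ] ℂ => f x) (clm_ext_pureTensor
    (S := innerSL ℂ (pureTensor (S a) (T b)) ∘L tensorCLM ρ σ)
    (T := innerSL ℂ (pureTensor (a : EA) (b : EB)) ∘L tensorCLM K L) hpure)

theorem tensorDomain_mono {p p' : Submodule ℂ EA} {q q' : Submodule ℂ EB} (hp : p ≤ p')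
    (hq : q ≤ q') : tensorDomain p q ≤ tensorDomain p' q' := by
  rintro _ ⟨t, rfl⟩
  induction t with
  | zero => rw [map_zero]; exact Submodule.zero_mem _
  | tmul a b => exact ⟨(⟨a, hp a.2⟩ : p') ⊗ₜ (⟨b, hq b.2⟩ : q'), rfl⟩
  | add s t hs ht => rw [map_add]; exact Submodule.add_mem _ hs ht

theorem IsSymmetric.tensorOne (hS : IsSymmetric S) : IsSymmetric (tensorOne (EB := EB) S) :=
  hS.tensorPMap isSymmetric_id_toPMap_top

theorem IsSymmetric.oneTensor (hT : IsSymmetric T) : IsSymmetric (oneTensor (EA := EA) T) :=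
  isSymmetric_id_toPMap_top.tensorPMap hT

theorem tensorDomain_le_domain_tensorOne_add_oneTensor :
    tensorDomain S.domain T.domain ≤ (tensorOne S + oneTensor T).domain :=
  le_inf (tensorDomain_mono le_rfl le_top) (tensorDomain_mono le_top le_rfl)

end TensorPMap

section WeakTrace

variable {E F κ : Type*} [NormedAddCommGroup E] [InnerProductSpace ℂ E] [CompleteSpace E]
  [NormedAddCommGroup F] [InnerProductSpace ℂ F] [CompleteSpace F]
  {S T : E →ₗ.[ℂ] E} {ρ K : E →L[ℂ] E} {s t : ℂ}

theorem IsWeakProduct.partialTrace {V : κ → F →L[ℂ] E} {T' : F →ₗ.[ℂ] F}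
    (hV : ResolvesIdentity V) (hVT : ∀ j, ∀ p ∈ T'.graph, (V j p.1, V j p.2) ∈ T.graph)
    (hρ : IsTraceClass ρ) (hK : IsTraceClass K) (h : IsWeakProduct T ρ K) :
    IsWeakProduct T' (partialTrace V ρ) (partialTrace V K) := by
  intro p hp x
  refine (hasSum_inner_partialTrace hV hρ p.2 x).unique ?_
  exact (hasSum_inner_partialTrace hV hK p.1 x).congr_fun fun j => h _ (hVT j p hp) _

/-- The expectation value `tr (T ρ)` exists in the weak sense and equals `t`. -/
def HasWeakTrace (T : E →ₗ.[ℂ] E) (ρ : E →L[ℂ] E) (t : ℂ) : Prop :=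
  ∃ K, IsWeakProduct T ρ K ∧ IsTraceClass K ∧ trace K = t

theorem HasWeakTrace.closure (h : HasWeakTrace T ρ t) : HasWeakTrace T.closure ρ t := by
  obtain ⟨K, hK, hK'⟩ := h
  exact ⟨K, hK.closure, hK'⟩

theorem HasTrace.hasWeakTrace (hT : IsSymmetric T) (h : HasTrace T.closure ρ) :
    HasWeakTrace T ρ (trace (productOp T.closure ρ)) := by
  obtain ⟨K, hK, hKtc⟩ := h
  exact ⟨K, hK.isWeakProduct hT, hKtc, by rw [hK.productOp_eq]⟩

theorem HasWeakTrace.add (hS : HasWeakTrace S ρ s) (hT : HasWeakTrace T ρ t) :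
    HasWeakTrace (S + T) ρ (s + t) := by
  obtain ⟨K, hK, hKtc, rfl⟩ := hS
  obtain ⟨L, hL, hLtc, rfl⟩ := hT
  exact ⟨K + L, hK.add hL, hKtc.add hLtc, trace_add hKtc hLtc⟩

theorem IsDensityOperator.hasWeakTrace_id_toPMap_top (hρ : IsDensityOperator ρ) :
    HasWeakTrace ((LinearMap.id : E →ₗ[ℂ] E).toPMap ⊤) ρ 1 :=
  ⟨ρ, isWeakProduct_id_toPMap_top ρ, hρ.isTraceClass, hρ.trace_eq_one⟩

theorem HasWeakTrace.partialTrace {V : κ → F →L[ℂ] E} {T' : F →ₗ.[ℂ] F}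
    (hV : ResolvesIdentity V) (hVT : ∀ j, ∀ p ∈ T'.graph, (V j p.1, V j p.2) ∈ T.graph)
    (hρ : IsTraceClass ρ) (h : HasWeakTrace T ρ t) : HasWeakTrace T' (partialTrace V ρ) t := by
  obtain ⟨K, hK, hKtc, rfl⟩ := h
  exact ⟨_, hK.partialTrace hV hVT hρ hKtc, hKtc.partialTrace hV, trace_partialTrace hV hKtc⟩

theorem HasWeakTrace.tensorPMap {T' : F →ₗ.[ℂ] F} {σ : F →L[ℂ] F} (hT : HasWeakTrace T ρ s)
    (hT' : HasWeakTrace T' σ t) :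
    HasWeakTrace (tensorPMap T T') (tensorCLM ρ σ) (s * t) := by
  obtain ⟨K, hK, hKtc, rfl⟩ := hT
  obtain ⟨L, hL, hLtc, rfl⟩ := hT'
  exact ⟨_, hK.tensorPMap hL, hKtc.tensorCLM hLtc, trace_tensorCLM hKtc hLtc⟩

theorem HasWeakTrace.tensorOne_tensorCLM_traceOut
    {ρ : HilbertTensor E F →L[ℂ] HilbertTensor E F} (hρ : IsDensityOperator ρ)
    (h : HasWeakTrace (tensorOne T) ρ t) :
    HasWeakTrace (tensorOne T) (tensorCLM (traceOutRight ρ) (traceOutLeft ρ)) t := by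
  have hA : HasWeakTrace T (traceOutRight ρ) t := by
    rw [traceOutRight_eq_partialTrace]
    exact h.partialTrace (resolvesIdentity_tmulRight _)
      (fun _ _ hp => tmulRight_mem_tensorOne_graph _ hp) hρ.isTraceClass
  rw [← mul_one t]
  exact hA.tensorPMap hρ.traceOutLeft.hasWeakTrace_id_toPMap_top

theorem HasWeakTrace.oneTensor_tensorCLM_traceOut
    {ρ : HilbertTensor F E →L[ℂ] HilbertTensor F E} (hρ : IsDensityOperator ρ)
    (h : HasWeakTrace (oneTensor T) ρ t) :
    HasWeakTrace (oneTensor T) (tensorCLM (traceOutRight ρ) (traceOutLeft ρ)) t := by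
  have hB : HasWeakTrace T (traceOutLeft ρ) t := by
    rw [traceOutLeft_eq_partialTrace]
    exact h.partialTrace (resolvesIdentity_tmulLeft _)
      (fun _ _ hp => tmulLeft_mem_oneTensor_graph _ hp) hρ.isTraceClass
  rw [← one_mul t]
  exact hρ.traceOutRight.hasWeakTrace_id_toPMap_top.tensorPMap hB

end WeakTrace

section GibbsVariational

universe u

variable {E : Type u} {κ : Type*} [NormedAddCommGroup E] [InnerProductSpace ℂ E] [CompleteSpace E]
  {H : E →ₗ.[ℂ] E} {σ : E →L[ℂ] E} {t : ℂ} {φ : HilbertBasis κ ℂ E} {ε : κ → ℝ} {β : ℝ}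

theorem IsEnergyBasis.hasSum_mul_inner (hφ : IsEnergyBasis φ ε H) (h : HasWeakTrace H σ t) :
    HasSum (fun k => (ε k : ℂ) * ⟪φ k, σ (φ k)⟫_ℂ) t := by
  obtain ⟨K, hK, hKtc, rfl⟩ := h
  refine (hKtc.hasSum_trace φ).congr_fun fun k => ?_
  rw [← hK _ (hφ k), inner_smul_left, Complex.conj_ofReal]

theorem IsEnergyBasis.im_eq_zero (hφ : IsEnergyBasis φ ε H) (hσ : 0 ≤ σ)
    (h : HasWeakTrace H σ t) : t.im = 0 := by
  refine (Complex.hasSum_im (hφ.hasSum_mul_inner h)).unique ?_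
  have him (k : κ) : (⟪φ k, σ (φ k)⟫_ℂ).im = 0 :=
    (Complex.nonneg_iff.1 (nonneg_iff_forall_inner_nonneg.1 hσ (φ k))).2.symm
  simp only [Complex.im_ofReal_mul, him, mul_zero, hasSum_zero]

theorem IsEnergyBasis.hasSum_affine_mul_inner (hφ : IsEnergyBasis φ ε H) (hσ : IsDensityOperator σ)
    (h : HasWeakTrace H σ t) (β c : ℝ) :
    HasSum (fun k => (β * ε k + c) * (⟪φ k, σ (φ k)⟫_ℂ).re) (β * t.re + c) := by
  have henergy := Complex.hasSum_re (hφ.hasSum_mul_inner h)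
  have htrace := Complex.hasSum_re (hσ.isTraceClass.hasSum_trace φ)
  rw [hσ.trace_eq_one, Complex.one_re] at htrace
  have hsum := (henergy.mul_left β).add (htrace.mul_left c)
  rw [mul_one] at hsum
  refine hsum.congr_fun fun k => ?_
  rw [Complex.re_ofReal_mul]
  ring

theorem HasWeakTrace.im_eq_zero (hH : IsSelfAdjoint H) (hβ : 0 < β)
    (hZ : partitionFunction β H < ⊤) (hσ : IsDensityOperator σ) (h : HasWeakTrace H σ t) :
    t.im = 0 := by
  obtain ⟨ι, φ, ε, hφ, -⟩ := exists_isEnergyBasis hH hβ hZ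
  exact hφ.im_eq_zero hσ.nonneg h

variable [Nontrivial E]

theorem exists_isDiagonal_gibbsState_hasSum_neg_log_mul (hH : IsSelfAdjoint H) (hβ : 0 < β)
    (hZ : partitionFunction β H < ⊤) :
    ∃ (ι : Type u) (φ : HilbertBasis ι ℂ E) (q : ι → ℝ), IsDiagonal φ q (gibbsState β H) ∧
      (∀ k, q k ∈ Set.Ioc 0 1) ∧ ∀ σ t, IsDensityOperator σ → HasWeakTrace H σ t →
        HasSum (fun k => -Real.log (q k) * (⟪φ k, σ (φ k)⟫_ℂ).re)
          (β * t.re + Real.log (partitionFunction β H).toReal) := by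
  obtain ⟨ι, φ, ε, hφ, hdiag⟩ := exists_isEnergyBasis_isDiagonal_gibbsState hH hβ hZ
  have hρ := isDensityOperator_gibbsState hH hβ hZ
  refine ⟨ι, φ, _, hdiag, fun k => ⟨Real.exp_pos _,
    (hdiag.mem_Icc_zero_one hρ.nonneg hρ.le_one k).2⟩, fun σ t hσ h => ?_⟩
  simpa only [Real.log_exp, neg_neg] using hφ.hasSum_affine_mul_inner hσ h β _

theorem HasWeakTrace.entropy_lt_top_and_toReal_le (hH : IsSelfAdjoint H) (hβ : 0 < β)
    (hZ : partitionFunction β H < ⊤) (hσ : IsDensityOperator σ) (h : HasWeakTrace H σ t) :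
    entropy σ < ⊤ ∧
      (entropy σ).toReal ≤ β * t.re + Real.log (partitionFunction β H).toReal := by
  obtain ⟨ι, φ, q, hdiag, hq, hsum⟩ := exists_isDiagonal_gibbsState_hasSum_neg_log_mul hH hβ hZ
  have hρ := isDensityOperator_gibbsState hH hβ hZ
  have hnonneg (k : ι) : 0 ≤ -Real.log (q k) * (⟪φ k, σ (φ k)⟫_ℂ).re :=
    mul_nonneg (neg_nonneg.2 (Real.log_nonpos (hq k).1.le (hq k).2)) (re_inner_nonneg hσ.nonneg _)
  have hle := hσ.entropy_le_tsum φ hq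
    ((hdiag.posTrace_eq hρ.nonneg).symm.trans hρ.posTrace_eq_one)
  rw [← ENNReal.ofReal_tsum_of_nonneg hnonneg (hsum σ t hσ h).summable,
    (hsum σ t hσ h).tsum_eq] at hle
  exact ⟨hle.trans_lt ENNReal.ofReal_lt_top,
    ENNReal.toReal_le_of_le_ofReal ((hsum σ t hσ h).nonneg hnonneg) hle⟩

theorem HasWeakTrace.toReal_entropy_gibbsState (hH : IsSelfAdjoint H) (hβ : 0 < β)
    (hZ : partitionFunction β H < ⊤) (h : HasWeakTrace H (gibbsState β H) t) :
    (entropy (gibbsState β H)).toReal =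
      β * t.re + Real.log (partitionFunction β H).toReal := by
  obtain ⟨ι, φ, q, hdiag, hq, hsum⟩ := exists_isDiagonal_gibbsState_hasSum_neg_log_mul hH hβ hZ
  have hρ := isDensityOperator_gibbsState hH hβ hZ
  have hterm (k : ι) : -Real.log (q k) * (⟪φ k, gibbsState β H (φ k)⟫_ℂ).re =
      Real.negMulLog (q k) := by
    rw [hdiag.inner_apply, Complex.ofReal_re, Real.negMulLog, mul_comm, mul_neg, neg_mul]
  have hnonneg (k : ι) : 0 ≤ Real.negMulLog (q k) := Real.negMulLog_nonneg (hq k).1.le (hq k).2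
  have hS := hsum _ t hρ h
  simp only [hterm] at hS
  rw [hdiag.entropy_eq hρ.nonneg hρ.le_one, ← ENNReal.ofReal_tsum_of_nonneg hnonneg hS.summable,
    hS.tsum_eq, ENNReal.toReal_ofReal (hS.nonneg hnonneg)]

theorem HasWeakTrace.toReal_entropy_sub_le {s : ℂ} (hH : IsSelfAdjoint H) (hβ : 0 < β)
    (hZ : partitionFunction β H < ⊤) (hs : HasWeakTrace H (gibbsState β H) s)
    (hσ : IsDensityOperator σ) (ht : HasWeakTrace H σ t) :
    (entropy σ).toReal - (entropy (gibbsState β H)).toReal ≤ β * (t - s).re := by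
  have hle := (ht.entropy_lt_top_and_toReal_le hH hβ hZ hσ).2
  rw [hs.toReal_entropy_gibbsState hH hβ hZ, Complex.sub_re]
  linarith

end GibbsVariational

section Bipartite

variable {EA EB : Type*} [NormedAddCommGroup EA] [InnerProductSpace ℂ EA]
  [NormedAddCommGroup EB] [InnerProductSpace ℂ EB]

theorem isSymmetric_interaction {S : EA →ₗ.[ℂ] EA} {T : EB →ₗ.[ℂ] EB}
    {V : HilbertTensor EA EB →ₗ.[ℂ] HilbertTensor EA EB} (hS : IsSymmetric S) (hT : IsSymmetric T)
    (hV : V.domain = tensorDomain S.domain T.domain)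
    (h : IsEssentiallySelfAdjoint (tensorOne S + oneTensor T + V)) : IsSymmetric V :=
  .of_add (hS.tensorOne.add hT.oneTensor)
    ((isSymmetric_of_isSelfAdjoint h).mono (LinearPMap.le_closure _))
    (hV.trans_le tensorDomain_le_domain_tensorOne_add_oneTensor)

variable [CompleteSpace EA] [CompleteSpace EB]

theorem entropy_tensorCLM_lt_top_iff {ρ : EA →L[ℂ] EA} {σ : EB →L[ℂ] EB}
    (hρ : IsDensityOperator ρ) (hσ : IsDensityOperator σ) :
    entropy (tensorCLM ρ σ) < ⊤ ↔ entropy ρ < ⊤ ∧ entropy σ < ⊤ := by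
  rw [hρ.entropy_tensorCLM hσ, ENNReal.add_lt_top]

theorem mutualInformation_eq_toReal_entropy_sub
    {ρ : HilbertTensor EA EB →L[ℂ] HilbertTensor EA EB} (hρ : IsDensityOperator ρ)
    (hA : entropy (traceOutRight ρ) < ⊤) (hB : entropy (traceOutLeft ρ) < ⊤) :
    mutualInformation ρ =
      (entropy (tensorCLM (traceOutRight ρ) (traceOutLeft ρ))).toReal - (entropy ρ).toReal := by
  rw [mutualInformation, hρ.traceOutRight.entropy_tensorCLM hρ.traceOutLeft,
    ENNReal.toReal_add hA.ne hB.ne]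

theorem traceOutRight_zero :
    traceOutRight (0 : HilbertTensor EA EB →L[ℂ] HilbertTensor EA EB) = 0 := by
  simp [traceOutRight]

theorem traceOutLeft_zero :
    traceOutLeft (0 : HilbertTensor EA EB →L[ℂ] HilbertTensor EA EB) = 0 := by
  simp [traceOutLeft]

end Bipartite

section Zero

variable {E : Type*} [NormedAddCommGroup E] [InnerProductSpace ℂ E] [CompleteSpace E]

theorem trace_zero : trace (0 : E →L[ℂ] E) = 0 := by
  simp [trace]

theorem entropy_zero : entropy (0 : E →L[ℂ] E) = 0 := by
  simp [entropy, posTrace]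

end Zero

end QuantumThermal

end

open QuantumThermal in
theorem mainTheorem3 {EA EB : Type*}
    [NormedAddCommGroup EA] [InnerProductSpace ℂ EA] [CompleteSpace EA]
    [NormedAddCommGroup EB] [InnerProductSpace ℂ EB] [CompleteSpace EB]
    (HA : EA →ₗ.[ℂ] EA) (HB : EB →ₗ.[ℂ] EB)
    (Hbd HAB : HilbertTensor EA EB →ₗ.[ℂ] HilbertTensor EA EB)
    (hA_dense : Dense (HA.domain : Set EA)) (hA_symm : IsSymmetric HA)
    (hB_dense : Dense (HB.domain : Set EB)) (hB_symm : IsSymmetric HB)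
    (hbd_dom : Hbd.domain = tensorDomain HA.domain HB.domain)
    (hHAB : HAB = tensorOne HA + oneTensor HB + Hbd)
    (hHAB_esa : IsEssentiallySelfAdjoint HAB)
    (β : ℝ) (hβ : 0 < β)
    (hZ : partitionFunction β HAB.closure < ⊤)
    (ρAB : HilbertTensor EA EB →L[ℂ] HilbertTensor EA EB)
    (hρAB : ρAB = gibbsState β HAB.closure)
    (ρA : EA →L[ℂ] EA) (hρA : ρA = traceOutRight ρAB)
    (ρB : EB →L[ℂ] EB) (hρB : ρB = traceOutLeft ρAB)
    (hA_tr : HasTrace (tensorOne (EB := EB) HA).closure ρAB)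
    (hB_tr : HasTrace (oneTensor (EA := EA) HB).closure ρAB)
    (hbd_tr : HasTrace Hbd.closure ρAB)
    (hbd_tr' : HasTrace Hbd.closure (tensorCLM ρA ρB)) :
    entropy ρAB < ⊤ ∧ entropy ρA < ⊤ ∧ entropy ρB < ⊤ ∧
    HasTrace Hbd.closure (tensorCLM ρA ρB - ρAB) ∧
    (trace (productOp Hbd.closure (tensorCLM ρA ρB - ρAB))).im = 0 ∧
    mutualInformation ρAB ≤
      β * (trace (productOp Hbd.closure (tensorCLM ρA ρB - ρAB))).re := by
  subst hρA hρB hHAB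
  rcases subsingleton_or_nontrivial (HilbertTensor EA EB) with _ | _
  · have hzero (T : HilbertTensor EA EB →L[ℂ] HilbertTensor EA EB) : T = 0 := Subsingleton.elim _ _
    have hbd : HasTrace Hbd.closure 0 := hzero ρAB ▸ hbd_tr
    simp [hzero ρAB, hzero (productOp _ _), hzero (tensorCLM _ _), traceOutRight_zero,
      traceOutLeft_zero, trace_zero, entropy_zero, mutualInformation, hbd]
  · subst hρAB
    have hbd := isSymmetric_interaction hA_symm hB_symm hbd_dom hHAB_esa
    have hρ := isDensityOperator_gibbsState hHAB_esa hβ hZ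
    have hσ := hρ.traceOutRight.tensorCLM hρ.traceOutLeft
    have hEA := hA_tr.hasWeakTrace hA_symm.tensorOne
    have hEB := hB_tr.hasWeakTrace hB_symm.oneTensor
    have hEρ := ((hEA.add hEB).add (hbd_tr.hasWeakTrace hbd)).closure
    have hEσ := (((hEA.tensorOne_tensorCLM_traceOut hρ).add
      (hEB.oneTensor_tensorCLM_traceOut hρ)).add (hbd_tr'.hasWeakTrace hbd)).closure
    have him := (hEσ.im_eq_zero hHAB_esa hβ hZ hσ).trans (hEρ.im_eq_zero hHAB_esa hβ hZ hρ).symm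
    have hle := HasWeakTrace.toReal_entropy_sub_le hHAB_esa hβ hZ hEρ hσ hEσ
    have hSρ := (hEρ.entropy_lt_top_and_toReal_le hHAB_esa hβ hZ hρ).1
    obtain ⟨hSA, hSB⟩ := (entropy_tensorCLM_lt_top_iff hρ.traceOutRight hρ.traceOutLeft).1
      (hEσ.entropy_lt_top_and_toReal_le hHAB_esa hβ hZ hσ).1
    rw [← sub_eq_zero, ← Complex.sub_im, add_sub_add_left_eq_sub] at him
    rw [add_sub_add_left_eq_sub, ← mutualInformation_eq_toReal_entropy_sub hρ hSA hSB] at hle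
    rw [hbd_tr'.trace_productOp_sub hbd_tr]
    exact ⟨hSρ, hSA, hSB, hbd_tr'.sub hbd_tr, him, hle⟩
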